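/- Let $d\ge 1$, $N\ge 2$, let $2^*=\infty$ if $d\le 2$ and $2^*=2d/(d-2)$ if $d\ge 3$, and let $p\in(2,2^*)$. Let $g:\mathbb C^N\to\mathbb R$ be twice continuously differentiable (as a function on $\mathbb R^{2N}$) and homogeneous of degree $p$, i.e. $g(rz)=r^pg(z)$ for all $r\ge 0$, $z\in\mathbb C^N$. Put $F_j=\frac2p\,\partial_{\overline{z_j}}g$ and consider, for $\omega>0$, the system $$-\Delta u_j+\omega u_j=-F_j(u_1,\dots,u_N)\quad\text{on }\mathbb R^d,\qquad j=1,\dots,N. \tag{gE$_\omega$}$$ For $u\in (H^1(\mathbb R^d;\mathbb C))^N$ let $$S_\omega(u)=\sum_{j=1}^N\int_{\mathbb R^d}\tfrac12|\nabla u_j|^2\,dx+\int_{\mathbb R^d}\tfrac1p\,g(u)\,dx+\omega\sum_{j=1}^N\int_{\mathbb R^d}\tfrac12|u_j|^2\,dx ,$$ let $\mathcal A_\omega=\{\Phi\in (H^1(\mathbb R^d))^N:\Phi\ne0,\ S_\omega'(\Phi)=0\}$ (the nontrivial solutions of (gE$_\omega$)), let $\mathcal G_\omega=\{\Phi\in\mathcal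 A_\omega: S_\omega(\Phi)=\inf_{\mathcal A_\omega}S_\omega\}$, and put $\mathcal A=\bigcup_{\omega>0}\mathcal A_\omega$, $\mathcal G=\bigcup_{\omega>0}\mathcal G_\omega$. Elements of $\mathcal A\setminus\mathcal G$ are called excited states. Let $Q\in H^1(\mathbb R^d)$ be the positive radial weak solution of $-\Delta Q+Q=Q^{p-1}$, and for $\omega,a>0$ let $Q_{\omega,a}(x)=(\omega/a)^{1/(p-2)}Q(\sqrt\omega\,x)$. Let $\partial B=\{z\in\mathbb C^N:|z_1|^2+\dots+|z_N|^2=1\}$, $g_{\min}=\min_{\partial B}g$, and for $w\in\partial B$ let $$\mathcal R(w,\omega,a)=\{\,w\,Q_{\omega,a}(\cdot-y): y\in\mathbb R^d\,\}.$$ **Theorem.** Let $w\in\partial B$. 1. For every $a>0$: $\mathcal R(w,\omega,a)\subset\mathcal A_\omega$ for all $\omega>0$ if and only if $w$ is a critical point of $g|_{\partial B}$ and $a=-g(w)>0$. The same equivalence holds with $\mathcal A_\omega$ replaced by the set of nonzero weak (distributional) solutions of (gE$_\omega$) in $(H^1(\mathbb R^d))^N$. 2. In particular, if $w$ is a critical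 point of $g|_{\partial B}$ with $g(w)<0$ and $g(w)\ne g_{\min}$, then for every $\omega>0$ all elements of $\mathcal R(w,\omega,-g(w))$ belong to $\mathcal A_\omega$ and are (scalar-type) excited states. -/

import Mathlib

open MeasureTheory


namespace ScalarSolitons

noncomputable section

/-- Physical space `ℝ^d`. -/
abbrev Sp (d : ℕ) : Type := EuclideanSpace ℝ (Fin d)

/-- The target space `ℂ^N`, with `|z|² = |z_1|² + ⋯ + |z_N|²`. -/
abbrev Cn (N : ℕ) : Type := EuclideanSpace ℂ (Fin N)

/-- `L²(ℝ^d; ℂ^N)`. -/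
abbrev L2 (d N : ℕ) : Type := Lp (Cn N) 2 (volume : Measure (Sp d))

/-- Test functions: smooth, compactly supported, real valued. -/
def IsTest {d : ℕ} (φ : Sp d → ℝ) : Prop :=
  ContDiff ℝ (⊤ : ℕ∞) φ ∧ HasCompactSupport φ

/-- The `k`-th classical partial derivative of a test function. -/
def pderiv {d : ℕ} (k : Fin d) (φ : Sp d → ℝ) (x : Sp d) : ℝ :=
  fderiv ℝ φ x (EuclideanSpace.single k 1)

/-- `v` is the `k`-th weak partial derivative of `u` on `ℝ^d`
(used for square integrable `u` and `v`). -/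
def IsWeakPartial {d : ℕ} {F : Type*} [NormedAddCommGroup F] [NormedSpace ℝ F]
    (k : Fin d) (u v : Sp d → F) : Prop :=
  ∀ φ : Sp d → ℝ, IsTest φ → ∫ x, pderiv k φ x • u x = -∫ x, φ x • v x

lemma IsTest.memLp {d : ℕ} {φ : Sp d → ℝ} (h : IsTest φ) :
    MemLp φ 2 (volume : Measure (Sp d)) :=
  h.1.continuous.memLp_of_hasCompactSupport h.2

lemma IsTest.memLp_pderiv {d : ℕ} {φ : Sp d → ℝ} (h : IsTest φ) (k : Fin d) :
    MemLp (pderiv k φ) 2 (volume : Measure (Sp d)) := by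
  refine Continuous.memLp_of_hasCompactSupport ?_ ?_
  · exact (h.1.continuous_fderiv (by simp)).clm_apply continuous_const
  · exact h.2.fderiv_apply (𝕜 := ℝ) _

lemma integrable_smul_L2 {d N : ℕ} {φ : Sp d → ℝ} (h : MemLp φ 2 volume) (u : L2 d N) :
    Integrable (fun x => φ x • u x) volume :=
  memLp_one_iff_integrable.1 ((Lp.memLp u).smul h)

/-- The Sobolev space `H¹(ℝ^d; ℂ^N) = (H¹(ℝ^d))^N`, as the real vector space of pairs `(u, ∇u)` with
`u ∈ L²` and all weak partial derivatives `∂_1 u, …, ∂_d u` in `L²`.  The second component is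
determined by `u`, and the norm inherited from the product is equivalent to the usual `H¹` norm. -/
def H1 (d N : ℕ) : Submodule ℝ (L2 d N × (Fin d → L2 d N)) where
  carrier := {U | ∀ k, IsWeakPartial k (U.1 : Sp d → Cn N) (U.2 k : Sp d → Cn N)}
  zero_mem' := by
    intro k φ _
    have h0 : ((0 : L2 d N) : Sp d → Cn N) =ᵐ[volume] 0 := Lp.coeFn_zero _ _ _
    have e : ∀ ψ : Sp d → ℝ, ∫ x, ψ x • ((0 : L2 d N) : Sp d → Cn N) x = 0 := by
      intro ψ
      rw [integral_congr_ae (g := fun _ => 0), integral_zero]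
      filter_upwards [h0] with x hx
      rw [hx, Pi.zero_apply, smul_zero]
    change ∫ x, pderiv k φ x • ((0 : L2 d N) : Sp d → Cn N) x =
      -∫ x, φ x • ((0 : L2 d N) : Sp d → Cn N) x
    rw [e, e, neg_zero]
  add_mem' := by
    intro U V hU hV k φ hφ
    have e : ∀ (ψ : Sp d → ℝ), MemLp ψ 2 volume → ∀ u v : L2 d N,
        ∫ x, ψ x • ((u + v : L2 d N) : Sp d → Cn N) x =
          (∫ x, ψ x • u x) + ∫ x, ψ x • v x := by
      intro ψ hψ u v
      rw [← integral_add (integrable_smul_L2 hψ u) (integrable_smul_L2 hψ v)]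
      refine integral_congr_ae ?_
      filter_upwards [Lp.coeFn_add u v] with x hx
      rw [hx, Pi.add_apply, smul_add]
    change ∫ x, pderiv k φ x • ((U.1 + V.1 : L2 d N) : Sp d → Cn N) x =
      -∫ x, φ x • ((U.2 k + V.2 k : L2 d N) : Sp d → Cn N) x
    rw [e _ (hφ.memLp_pderiv k), e _ hφ.memLp, hU k φ hφ, hV k φ hφ, neg_add]
  smul_mem' := by
    intro c U hU k φ hφ
    have e : ∀ (ψ : Sp d → ℝ) (u : L2 d N),
        ∫ x, ψ x • ((c • u : L2 d N) : Sp d → Cn N) x = c • ∫ x, ψ x • u x := by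
      intro ψ u
      rw [← integral_smul]
      refine integral_congr_ae ?_
      filter_upwards [Lp.coeFn_smul c u] with x hx
      simp only [hx, Pi.smul_apply]
      rw [smul_comm]
    change ∫ x, pderiv k φ x • ((c • U.1 : L2 d N) : Sp d → Cn N) x =
      -∫ x, φ x • ((c • U.2 k : L2 d N) : Sp d → Cn N) x
    rw [e, e, hU k φ hφ, smul_neg]

/-- The function (class) underlying an element of `H¹`. -/
def H1.fn {d N : ℕ} (U : H1 d N) : Sp d → Cn N := (U.1.1 : Sp d → Cn N)

/-- The weak partial derivative `∂_k u` of an element of `H¹`. -/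
def H1.partialFn {d N : ℕ} (U : H1 d N) (k : Fin d) : Sp d → Cn N :=
  (U.1.2 k : Sp d → Cn N)

/-- The functions on `ℝ^d` whose class (modulo null sets) lies in a given subset of `H¹`. -/
def functionsOf {d N : ℕ} (A : Set (H1 d N)) : Set (Sp d → Cn N) :=
  {f | ∃ U ∈ A, H1.fn U =ᵐ[volume] f}

/-- The assumption on the potential `g` and its degree of homogeneity `p`:
`g` is `C²` in the real sense, positively homogeneous of degree `p`, and `2 < p < 2^*`, where
`2^* = ∞` for `d ≤ 2` and `2^* = 2d/(d-2)` for `d ≥ 3`. -/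
structure Admissible (d : ℕ) {N : ℕ} (p : ℝ) (g : Cn N → ℝ) : Prop where
  contDiff : ContDiff ℝ 2 g
  homogeneous : ∀ (r : ℝ) (z : Cn N), 0 ≤ r → g (r • z) = r ^ p * g z
  two_lt : 2 < p
  subcritical : 3 ≤ d → p < 2 * (d : ℝ) / ((d : ℝ) - 2)

/-- The nonlinearity `F_j = (2/p) ∂g/∂z̄_j`, where `∂/∂z̄ = (∂/∂x + i ∂/∂y)/2`. -/
def nonlin {N : ℕ} (p : ℝ) (g : Cn N → ℝ) (j : Fin N) (z : Cn N) : ℂ :=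
  ((2 / p : ℝ) : ℂ) * ((1 / 2 : ℂ) *
    ((fderiv ℝ g z (EuclideanSpace.single j 1) : ℂ) +
      Complex.I * (fderiv ℝ g z (EuclideanSpace.single j Complex.I) : ℂ)))

/-- The energy `E(u) = ½ ∑_j ∫ |∇u_j|² + (1/p) ∫ g(u)`. -/
def energy {d N : ℕ} (p : ℝ) (g : Cn N → ℝ) (U : H1 d N) : ℝ :=
  (∑ k, ∫ x, 1 / 2 * ‖H1.partialFn U k x‖ ^ 2) + ∫ x, 1 / p * g (H1.fn U x)

/-- The mass `M(u) = ½ ∑_j ∫ |u_j|²`. -/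
def mass {d N : ℕ} (U : H1 d N) : ℝ := ∫ x, 1 / 2 * ‖H1.fn U x‖ ^ 2

/-- The action `S_ω = E + ω M`. -/
def action {d N : ℕ} (p : ℝ) (g : Cn N → ℝ) (ω : ℝ) (U : H1 d N) : ℝ :=
  energy p g U + ω * mass U

/-- `𝒜_ω`: the nonzero `Φ ∈ (H¹)^N` with `S_ω'(Φ) = 0` (Fréchet derivative, real scalars). -/
def solSet (d : ℕ) {N : ℕ} (p : ℝ) (g : Cn N → ℝ) (ω : ℝ) : Set (H1 d N) :=
  {Φ | Φ ≠ 0 ∧ HasFDerivAt (action p g ω) (0 : H1 d N →L[ℝ] ℝ) Φ}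

/-- `𝒢_ω`: the elements of `𝒜_ω` whose action is the infimum of the action over `𝒜_ω`. -/
def groundSet (d : ℕ) {N : ℕ} (p : ℝ) (g : Cn N → ℝ) (ω : ℝ) : Set (H1 d N) :=
  {Φ | Φ ∈ solSet d p g ω ∧ IsGLB (action p g ω '' solSet d p g ω) (action p g ω Φ)}

/-- The excited states: `𝒜 \ 𝒢` with `𝒜 = ⋃_{ω>0} 𝒜_ω` and `𝒢 = ⋃_{ω>0} 𝒢_ω`. -/
def excitedSet (d : ℕ) {N : ℕ} (p : ℝ) (g : Cn N → ℝ) : Set (H1 d N) :=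
  (⋃ ω ∈ Set.Ioi (0 : ℝ), solSet d p g ω) \ (⋃ ω ∈ Set.Ioi (0 : ℝ), groundSet d p g ω)

/-- The nonzero `H¹` weak solutions of `-Δu_j + ω u_j = -F_j(u)`, `j = 1, …, N`. -/
def weakSolSet (d : ℕ) {N : ℕ} (p : ℝ) (g : Cn N → ℝ) (ω : ℝ) : Set (H1 d N) :=
  {Φ | Φ ≠ 0 ∧ ∀ (j : Fin N) (φ : Sp d → ℝ), IsTest φ →
    (∑ k, ∫ x, pderiv k φ x • H1.partialFn Φ k x j) + (ω : ℂ) * ∫ x, φ x • H1.fn Φ x j =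
      -∫ x, φ x • nonlin p g j (H1.fn Φ x)}

/-- `Q ∈ H¹(ℝ^d)` is a positive radial (weak) solution of `-ΔQ + Q = Q^{p-1}`. -/
structure IsPositiveRadialSolution {d : ℕ} (p : ℝ) (Q : Sp d → ℝ) : Prop where
  pos : ∀ x, 0 < Q x
  radial : ∀ x y, ‖x‖ = ‖y‖ → Q x = Q y
  memLp : MemLp Q 2 volume
  weak_solution : ∃ DQ : Fin d → Sp d → ℝ,
    (∀ k, MemLp (DQ k) 2 volume ∧ IsWeakPartial k Q (DQ k)) ∧
    ∀ φ : Sp d → ℝ, IsTest φ →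
      (∑ k, ∫ x, DQ k x * pderiv k φ x) + ∫ x, Q x * φ x = ∫ x, Q x ^ (p - 1) * φ x

/-- `Q_{ω,a}(x) = (ω/a)^{1/(p-2)} Q(√ω x)`. -/
def scaledQ {d : ℕ} (p : ℝ) (Q : Sp d → ℝ) (ω a : ℝ) (x : Sp d) : ℝ :=
  (ω / a) ^ (1 / (p - 2)) * Q (Real.sqrt ω • x)

/-- `ℛ(w, ω, a) = { w Q_{ω,a}(· - y) : y ∈ ℝ^d }`. -/
def scalarFamily {d N : ℕ} (p : ℝ) (Q : Sp d → ℝ) (w : Cn N) (ω a : ℝ) :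
    Set (Sp d → Cn N) :=
  {f | ∃ y : Sp d, f = fun x => scaledQ p Q ω a (x - y) • w}

/-- `∂B`, the unit sphere of `ℂ^N`. -/
def bdryB (N : ℕ) : Set (Cn N) := Metric.sphere 0 1

/-- `w ∈ ∂B` is a critical point of `g|_{∂B}`: `g` is stationary at `w` along every `C¹` curve
lying in `∂B` and passing through `w`. -/
def IsCriticalOnSphere {N : ℕ} (g : Cn N → ℝ) (w : Cn N) : Prop :=
  w ∈ bdryB N ∧ ∀ γ : ℝ → Cn N, ContDiff ℝ 1 γ → (∀ t, γ t ∈ bdryB N) → γ 0 = w →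
    HasDerivAt (fun t => g (γ t)) 0 0

/-- `g_min = min_{∂B} g`. -/
def gMin {N : ℕ} (g : Cn N → ℝ) : ℝ := sInf (g '' bdryB N)

end

end ScalarSolitons

/-! A positive profile `q = Q_{ω,a}(· - y)` solves `-Δq + ω q = a q^{p-1}`, and the nonlinearity is
homogeneous of degree `p - 1`. Hence inserting `u = q w` in the `j`-th weak equation, tested against
`φ`, leaves the defect `(∫ φ q^{p-1}) (a w_j + F_j(w))` (`IsProfile.weakDefect_eq`). A bump function
makes the integral positive, so `q w` is a solution iff `F(w) = -a w`. By the Lagrange multiplier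
rule on the sphere and Euler's identity, this says that `w` is critical and `a = -g(w)`
(`nonlin_eq_iff_isCriticalOnSphere`).

The analytic weight lies in `solSet_eq_weakSolSet`: critical points of `S_ω` in the Fréchet sense
are exactly the weak solutions. This needs differentiability of `u ↦ ∫ g(u)` on `H¹`, which rests on
the Sobolev embedding into `L^p`, and density of test functions, which extends the weak equation to
all directions in `H¹`.

For excited states, pairing `S_ω'(u) = 0` with `u` gives `S_ω(u) = (1/2 - 1/p)(‖∇u‖² + ω‖u‖²)`. On
scalar solutions this is a constant times `(ω/a)^{2/(p-2)}`, strictly decreasing in `a`. A minimizer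
`w₀` of `g` on the sphere is critical with `-g(w₀) > -g(w)`, so it carries a solution of smaller
action at the same frequency. A nonzero solution determines its frequency, so it cannot be a ground
state for another one either. -/

namespace ScalarSolitons

/-! ### `H¹` as pairs (function, weak gradient), and its smooth compactly supported elements. -/

noncomputable section

variable {d N : ℕ}

lemma IsWeakPartial.congr {F : Type*} [NormedAddCommGroup F] [NormedSpace ℝ F] {k : Fin d}
    {u v u' v' : Sp d → F} (h : IsWeakPartial k u v) (hu : u =ᵐ[volume] u')
    (hv : v =ᵐ[volume] v') : IsWeakPartial k u' v' := by
  intro φ hφ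
  rw [← integral_congr_ae (hu.mono fun x hx => congrArg (pderiv k φ x • ·) hx),
    ← integral_congr_ae (hv.mono fun x hx => congrArg (φ x • ·) hx)]
  exact h φ hφ

/-- The element of `H¹` with prescribed function and weak partial derivatives. -/
def H1.ofFunctions (u : Sp d → Cn N) (v : Fin d → Sp d → Cn N) (hu : MemLp u 2 volume)
    (hv : ∀ k, MemLp (v k) 2 volume) (h : ∀ k, IsWeakPartial k u (v k)) : H1 d N :=
  ⟨(hu.toLp u, fun k => (hv k).toLp (v k)), fun k =>
    (h k).congr hu.coeFn_toLp.symm (hv k).coeFn_toLp.symm⟩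

section ofFunctions

variable {u : Sp d → Cn N} {v : Fin d → Sp d → Cn N} (hu : MemLp u 2 volume)
  (hv : ∀ k, MemLp (v k) 2 volume) (h : ∀ k, IsWeakPartial k u (v k))

lemma H1.fn_ofFunctions : H1.fn (H1.ofFunctions u v hu hv h) =ᵐ[volume] u :=
  hu.coeFn_toLp

lemma H1.partialFn_ofFunctions (k : Fin d) :
    H1.partialFn (H1.ofFunctions u v hu hv h) k =ᵐ[volume] v k :=
  (hv k).coeFn_toLp

end ofFunctions

lemma H1.memLp_fn (U : H1 d N) : MemLp (H1.fn U) 2 volume := Lp.memLp _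

lemma H1.memLp_partialFn (U : H1 d N) (k : Fin d) : MemLp (H1.partialFn U k) 2 volume :=
  Lp.memLp _

lemma H1.isWeakPartial (U : H1 d N) (k : Fin d) :
    IsWeakPartial k (H1.fn U) (H1.partialFn U k) := U.2 k

lemma IsWeakPartial.ae_unique {F : Type*} [NormedAddCommGroup F] [NormedSpace ℝ F]
    [CompleteSpace F] {k : Fin d} {u v v' : Sp d → F} (h : IsWeakPartial k u v)
    (h' : IsWeakPartial k u v') (hv : MemLp v 2 volume) (hv' : MemLp v' 2 volume) :
    v =ᵐ[volume] v' := by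
  refine ae_eq_of_integral_contDiff_smul_eq (hv.locallyIntegrable (by norm_num))
    (hv'.locallyIntegrable (by norm_num)) fun φ h1 h2 => ?_
  have := h φ ⟨h1, h2⟩
  rw [h' φ ⟨h1, h2⟩] at this
  exact (neg_injective this).symm

/-- Weak derivatives are unique almost everywhere, so the gradient component carries no extra
information and identities in `H¹` can be checked on the functions alone. -/
lemma H1.ext_fn {U V : H1 d N} (h : H1.fn U =ᵐ[volume] H1.fn V) : U = V := by
  refine Subtype.ext (Prod.ext (Lp.ext h) (funext fun k => Lp.ext ?_))
  exact ((H1.isWeakPartial U k).congr h Filter.EventuallyEq.rfl).ae_unique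
    (H1.isWeakPartial V k) (H1.memLp_partialFn U k) (H1.memLp_partialFn V k)

lemma H1.fn_zero : H1.fn (0 : H1 d N) =ᵐ[volume] 0 := Lp.coeFn_zero _ _ _

lemma H1.fn_add (U V : H1 d N) : H1.fn (U + V) =ᵐ[volume] fun x => H1.fn U x + H1.fn V x :=
  Lp.coeFn_add _ _

lemma H1.fn_sub (U V : H1 d N) : H1.fn (U - V) =ᵐ[volume] fun x => H1.fn U x - H1.fn V x :=
  Lp.coeFn_sub _ _

lemma H1.partialFn_sub (U V : H1 d N) (k : Fin d) :
    H1.partialFn (U - V) k =ᵐ[volume] fun x => H1.partialFn U k x - H1.partialFn V k x :=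
  Lp.coeFn_sub _ _

lemma H1.fn_smul (c : ℝ) (U : H1 d N) : H1.fn (c • U) =ᵐ[volume] fun x => c • H1.fn U x :=
  Lp.coeFn_smul _ _

lemma H1.eLpNorm_fn_le (U : H1 d N) : eLpNorm (H1.fn U) 2 volume ≤ ‖U‖ₑ := by
  have h : eLpNorm (H1.fn U) 2 volume = ‖U.1.1‖ₑ := (Lp.enorm_def _).symm
  rw [h, ← ofReal_norm, ← ofReal_norm]
  exact ENNReal.ofReal_le_ofReal (norm_fst_le U.1)

lemma H1.eLpNorm_partialFn_le (U : H1 d N) (k : Fin d) :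
    eLpNorm (H1.partialFn U k) 2 volume ≤ ‖U‖ₑ := by
  have h : eLpNorm (H1.partialFn U k) 2 volume = ‖U.1.2 k‖ₑ := (Lp.enorm_def _).symm
  rw [h, ← ofReal_norm, ← ofReal_norm]
  exact ENNReal.ofReal_le_ofReal ((norm_le_pi_norm U.1.2 k).trans (norm_snd_le U.1))

lemma H1.enorm_le {U : H1 d N} {C : ENNReal} (h0 : eLpNorm (H1.fn U) 2 volume ≤ C)
    (h1 : ∀ k, eLpNorm (H1.partialFn U k) 2 volume ≤ C) : ‖U‖ₑ ≤ C := by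
  rcases eq_or_ne C ⊤ with rfl | hC
  · exact le_top
  lift C to NNReal using hC
  have e0 : ‖U.1.1‖ ≤ C := by
    have h : eLpNorm (H1.fn U) 2 volume = ‖U.1.1‖ₑ := (Lp.enorm_def _).symm
    rw [h] at h0
    exact_mod_cast h0
  have e1 : ∀ k, ‖U.1.2 k‖ ≤ C := fun k => by
    have h : eLpNorm (H1.partialFn U k) 2 volume = ‖U.1.2 k‖ₑ := (Lp.enorm_def _).symm
    have := h1 k
    rw [h] at this
    exact_mod_cast this
  -- The norm inherited from the product is the maximum of the norms of all components.
  have : ‖U‖ ≤ C := max_le e0 ((pi_norm_le_iff_of_nonneg C.2).2 e1)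
  exact_mod_cast this

/-- Smooth compactly supported functions with values in `ℂ^N`. -/
def IsTestVec (f : Sp d → Cn N) : Prop :=
  ContDiff ℝ (⊤ : ℕ∞) f ∧ HasCompactSupport f

/-- The classical `k`-th partial derivative of a vector valued function. -/
def vpderiv (k : Fin d) (f : Sp d → Cn N) (x : Sp d) : Cn N :=
  fderiv ℝ f x (EuclideanSpace.single k 1)

namespace IsTestVec

variable {f : Sp d → Cn N} (hf : IsTestVec f)
include hf

lemma continuous_vpderiv (k : Fin d) : Continuous (vpderiv k f) :=
  (hf.1.continuous_fderiv (by simp)).clm_apply continuous_const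

lemma hasCompactSupport_vpderiv (k : Fin d) : HasCompactSupport (vpderiv k f) :=
  hf.2.fderiv_apply (𝕜 := ℝ) _

lemma memLp : MemLp f 2 (volume : Measure (Sp d)) :=
  hf.1.continuous.memLp_of_hasCompactSupport hf.2

lemma memLp_vpderiv (k : Fin d) : MemLp (vpderiv k f) 2 (volume : Measure (Sp d)) :=
  (hf.continuous_vpderiv k).memLp_of_hasCompactSupport (hf.hasCompactSupport_vpderiv k)

lemma isWeakPartial (k : Fin d) : IsWeakPartial k f (vpderiv k f) := by
  intro φ hφ
  have h : ∀ ψ : Sp d → ℝ, Continuous ψ → HasCompactSupport ψ → ∀ g : Sp d → Cn N,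
      Continuous g → Integrable (fun x => ψ x • g x) := fun ψ h1 h2 g hg =>
    (h1.smul hg).integrable_of_hasCompactSupport h2.smul_right
  have hc : Continuous (pderiv k φ) :=
    (hφ.1.continuous_fderiv (by simp)).clm_apply continuous_const
  have := integral_smul_fderiv_eq_neg_fderiv_smul_of_integrable (𝕜 := ℝ) (f := φ) (g := f)
    (μ := volume) (v := EuclideanSpace.single k 1)
    (h _ hc (hφ.2.fderiv_apply (𝕜 := ℝ) _) _ hf.1.continuous)
    (h _ hφ.1.continuous hφ.2 _ (hf.continuous_vpderiv k))
    (h _ hφ.1.continuous hφ.2 _ hf.1.continuous)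
    (fun x _ => hφ.1.differentiable (by simp) x) (fun x _ => hf.1.differentiable (by simp) x)
  exact (neg_eq_iff_eq_neg.2 this).symm

end IsTestVec

/-- The element of `H¹` given by a smooth compactly supported function. -/
def testElt (f : Sp d → Cn N) (hf : IsTestVec f) : H1 d N :=
  H1.ofFunctions f (fun k => vpderiv k f) hf.memLp hf.memLp_vpderiv hf.isWeakPartial

lemma fn_testElt {f : Sp d → Cn N} (hf : IsTestVec f) :
    H1.fn (testElt f hf) =ᵐ[volume] f := H1.fn_ofFunctions _ _ _

lemma partialFn_testElt {f : Sp d → Cn N} (hf : IsTestVec f) (k : Fin d) :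
    H1.partialFn (testElt f hf) k =ᵐ[volume] vpderiv k f := H1.partialFn_ofFunctions _ _ _ k

lemma IsTest.smul_const {φ : Sp d → ℝ} (hφ : IsTest φ) (c : Cn N) :
    IsTestVec (fun x => φ x • c) :=
  ⟨hφ.1.smul contDiff_const, hφ.2.smul_right⟩

lemma vpderiv_smul_const {φ : Sp d → ℝ} (hφ : IsTest φ) (c : Cn N) (k : Fin d) (x : Sp d) :
    vpderiv k (fun x => φ x • c) x = pderiv k φ x • c := by
  have h := (hφ.1.differentiable (by simp) x).hasFDerivAt.smul_const c
  rw [vpderiv, h.fderiv]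
  rfl

end

/-! ### Density of test functions in `H¹`: mollification, then cutoff. -/

noncomputable section

variable {d N : ℕ}

lemma tendsto_eLpNorm_translate_sub {F : Type*} [NormedAddCommGroup F]
    (u : Lp F 2 (volume : Measure (Sp d))) :
    Filter.Tendsto (fun y : Sp d => eLpNorm (fun x => u (x - y) - u x) 2 volume)
      (nhds 0) (nhds 0) := by
  have hmp : ∀ y : Sp d, MeasurePreserving (fun x : Sp d => x - y) volume volume :=
    fun y => measurePreserving_sub_right volume y
  -- The translations form a continuous family of measure preserving maps, and composition with such
  -- a family is continuous in `L²`.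
  let g : C(Sp d, C(Sp d, Sp d)) :=
    (ContinuousMap.mk (fun a : Sp d × Sp d => a.2 - a.1) (by fun_prop)).curry
  have hc : Continuous fun y : Sp d =>
      Lp.compMeasurePreserving (fun x : Sp d => x - y) (hmp y) u :=
    (continuous_const (y := u)).compMeasurePreservingLp (g := g) g.continuous hmp (by norm_num)
  have h0 : Lp.compMeasurePreserving (fun x : Sp d => x - 0) (hmp 0) u = u := by
    refine Lp.ext ((Lp.coeFn_compMeasurePreserving u (hmp 0)).trans ?_)
    exact Filter.Eventually.of_forall fun x => by simp
  have ht := (hc.sub (continuous_const (y := u))).enorm.tendsto 0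
  simp only [Pi.sub_apply, h0, sub_self, enorm_zero] at ht
  refine ht.congr fun y => ?_
  rw [Lp.enorm_def]
  refine eLpNorm_congr_ae ?_
  filter_upwards [Lp.coeFn_sub (Lp.compMeasurePreserving _ (hmp y) u) u,
    Lp.coeFn_compMeasurePreserving u (hmp y)] with x h1 h2
  rw [h1, Pi.sub_apply, h2]
  rfl

/-- The convolution of a bump function with a function. -/
def mollify {F : Type*} [NormedAddCommGroup F] [NormedSpace ℝ F] (ρ : ContDiffBump (0 : Sp d))
    (u : Sp d → F) : Sp d → F :=
  convolution (ρ.normed volume) u (ContinuousLinearMap.lsmul ℝ ℝ) volume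

section mollify

variable {F : Type*} [NormedAddCommGroup F] [NormedSpace ℝ F]

lemma eLpNorm_two_sq {α : Type*} {m : MeasurableSpace α} {G : Type*} [NormedAddCommGroup G]
    {μ : Measure α} (f : α → G) : eLpNorm f 2 μ ^ 2 = ∫⁻ x, ‖f x‖ₑ ^ 2 ∂μ := by
  have := eLpNorm_nnreal_pow_eq_lintegral (f := f) (p := 2) (μ := μ) (by norm_num)
  simpa only [NNReal.coe_ofNat, ENNReal.rpow_two, ENNReal.coe_ofNat] using this

/-- Cauchy–Schwarz after splitting `w = w^{1/2} w^{1/2}`. For `w` of total mass one it is Jensen's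
inequality for the square. -/
lemma sq_lintegral_mul_le {α : Type*} {m : MeasurableSpace α} {μ : Measure α}
    {w f : α → ENNReal} (hw : AEMeasurable w μ) (hf : AEMeasurable f μ) :
    (∫⁻ t, w t * f t ∂μ) ^ 2 ≤ (∫⁻ t, w t ∂μ) * ∫⁻ t, w t * f t ^ 2 ∂μ := by
  have h := ENNReal.lintegral_mul_le_Lp_mul_Lq μ Real.HolderConjugate.two_two
    (f := fun t => w t ^ (1 / 2 : ℝ)) (g := fun t => w t ^ (1 / 2 : ℝ) * f t)
    (hw.pow_const _) ((hw.pow_const _).mul hf)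
  have e1 : ∀ t, w t ^ (1 / 2 : ℝ) * w t ^ (1 / 2 : ℝ) = w t := fun t => by
    rw [← ENNReal.rpow_add_of_nonneg _ _ (by norm_num) (by norm_num)]
    norm_num
  have e2 : ∀ a : ENNReal, (a ^ (1 / 2 : ℝ)) ^ (2 : ℝ) = a := fun a => by
    rw [← ENNReal.rpow_mul]; norm_num
  simp only [Pi.mul_apply, ← mul_assoc, e1, e2, ENNReal.mul_rpow_of_nonneg _ _ zero_le_two] at h
  calc (∫⁻ t, w t * f t ∂μ) ^ 2
      ≤ ((∫⁻ t, w t ∂μ) ^ (1 / 2 : ℝ) * (∫⁻ t, w t * f t ^ (2 : ℝ) ∂μ) ^ (1 / 2 : ℝ)) ^ 2 := by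
        gcongr
    _ = _ := by
        rw [mul_pow, ← ENNReal.rpow_natCast, ← ENNReal.rpow_natCast, Nat.cast_ofNat, e2, e2]
        simp only [← ENNReal.rpow_two]

/-- The mollification error is an average of `u (x - t) - u x` against a probability density, so
Jensen applies pointwise. -/
lemma enorm_mollify_sub_sq_le [CompleteSpace F] (ρ : ContDiffBump (0 : Sp d)) {u : Sp d → F}
    (hu : LocallyIntegrable u volume) (hum : StronglyMeasurable u) (x : Sp d) :
    ‖mollify ρ u x - u x‖ₑ ^ 2 ≤
      ∫⁻ t, ENNReal.ofReal (ρ.normed volume t) * ‖u (x - t) - u x‖ₑ ^ 2 := by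
  set w : Sp d → ℝ := ρ.normed volume with hw
  have hwc : Continuous w := ρ.continuous_normed
  have hw0 : ∀ t, 0 ≤ w t := fun t => ρ.nonneg_normed t
  have hwi : Integrable w volume := ρ.integrable_normed
  have hi : Integrable (fun t => w t • u (x - t)) volume := by
    have := (ρ.hasCompactSupport_normed (μ := volume)).convolutionExists_left
      (ContinuousLinearMap.lsmul ℝ ℝ) hwc hu x
    exact this
  have hi2 : Integrable (fun t => w t • u x) volume := hwi.smul_const _
  have e : mollify ρ u x - u x = ∫ t, w t • (u (x - t) - u x) := by
    have : ∫ t, w t • u x = u x := by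
      rw [integral_smul_const, hw, ρ.integral_normed, one_smul]
    simp_rw [smul_sub]
    rw [integral_sub hi hi2, this]
    rfl
  have hm : Measurable fun t => ENNReal.ofReal (w t) := hwc.measurable.ennreal_ofReal
  have h1 : ∫⁻ t, ENNReal.ofReal (w t) = 1 := by
    rw [← ofReal_integral_eq_lintegral_ofReal hwi (Filter.Eventually.of_forall hw0), hw,
      ρ.integral_normed, ENNReal.ofReal_one]
  have hD : Measurable fun t => ‖u (x - t) - u x‖ₑ :=
    ((hum.comp_measurable (measurable_const.sub measurable_id)).sub
      stronglyMeasurable_const).enorm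
  calc ‖mollify ρ u x - u x‖ₑ ^ 2
      ≤ (∫⁻ t, ENNReal.ofReal (w t) * ‖u (x - t) - u x‖ₑ) ^ 2 := by
        gcongr
        rw [e]
        refine (enorm_integral_le_lintegral_enorm _).trans_eq (lintegral_congr fun t => ?_)
        rw [enorm_smul, Real.enorm_eq_ofReal (hw0 t)]
    _ ≤ 1 * _ := h1 ▸ sq_lintegral_mul_le hm.aemeasurable hD.aemeasurable
    _ = _ := one_mul _

/-- Integrating the pointwise bound and exchanging integrals by Tonelli leaves an average of squared
translation errors, in which only `t` in the support of the bump counts. -/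
lemma eLpNorm_mollify_sub_le [CompleteSpace F] (ρ : ContDiffBump (0 : Sp d)) {u : Sp d → F}
    (hu : LocallyIntegrable u volume) (hum : StronglyMeasurable u) {ε : ENNReal}
    (h : ∀ y : Sp d, ‖y‖ < ρ.rOut → eLpNorm (fun x => u (x - y) - u x) 2 volume ≤ ε) :
    eLpNorm (fun x => mollify ρ u x - u x) 2 volume ≤ ε := by
  rw [← ENNReal.pow_le_pow_left_iff two_ne_zero, eLpNorm_two_sq]
  have hwi : Integrable (ρ.normed volume) (volume : Measure (Sp d)) := ρ.integrable_normed
  have hm : Measurable fun t : Sp d => ENNReal.ofReal (ρ.normed volume t) :=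
    ρ.continuous_normed.measurable.ennreal_ofReal
  calc ∫⁻ x, ‖mollify ρ u x - u x‖ₑ ^ 2
      ≤ ∫⁻ x, ∫⁻ t, ENNReal.ofReal (ρ.normed volume t) * ‖u (x - t) - u x‖ₑ ^ 2 :=
        lintegral_mono fun x => enorm_mollify_sub_sq_le ρ hu hum x
    _ = ∫⁻ t, ∫⁻ x, ENNReal.ofReal (ρ.normed volume t) * ‖u (x - t) - u x‖ₑ ^ 2 := by
        refine lintegral_lintegral_swap (Measurable.aemeasurable ?_)
        refine (hm.comp measurable_snd).mul (Measurable.pow_const ?_ _)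
        exact ((hum.comp_measurable (measurable_fst.sub measurable_snd)).sub
          (hum.comp_measurable measurable_fst)).enorm
    _ ≤ ∫⁻ t, ENNReal.ofReal (ρ.normed volume t) * ε ^ 2 := by
        refine lintegral_mono fun t => ?_
        rw [lintegral_const_mul]
        · by_cases ht : ‖t‖ < ρ.rOut
          · gcongr
            rw [← eLpNorm_two_sq]
            exact pow_le_pow_left' (h t ht) 2
          · have : ρ.normed volume t = 0 := by
              rw [← Function.notMem_support, ρ.support_normed_eq]
              simpa using ht
            simp [this]
        · exact (((hum.comp_measurable (measurable_id.sub measurable_const)).sub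
            hum).enorm).pow_const _
    _ = ε ^ 2 := by
        rw [lintegral_mul_const _ hm, ← ofReal_integral_eq_lintegral_ofReal hwi
          (Filter.Eventually.of_forall fun t => ρ.nonneg_normed t), ρ.integral_normed,
          ENNReal.ofReal_one, one_mul]

lemma contDiff_mollify (ρ : ContDiffBump (0 : Sp d)) {u : Sp d → F}
    (hu : LocallyIntegrable u volume) : ContDiff ℝ (⊤ : ℕ∞) (mollify ρ u) :=
  (ρ.hasCompactSupport_normed).contDiff_convolution_left _ ρ.contDiff_normed hu

/-- The derivative falls on the kernel, and `y ↦ w (x - y)` is an admissible test function. The sign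
from the reflection cancels the sign in the definition of the weak derivative. -/
lemma fderiv_mollify [CompleteSpace F] (ρ : ContDiffBump (0 : Sp d)) {u v : Sp d → F} {k : Fin d}
    (hu : LocallyIntegrable u volume) (h : IsWeakPartial k u v) (x : Sp d) :
    fderiv ℝ (mollify ρ u) x (EuclideanSpace.single k 1) = mollify ρ v x := by
  set w : Sp d → ℝ := ρ.normed volume with hw
  have hws : ContDiff ℝ (⊤ : ℕ∞) w := ρ.contDiff_normed
  have hwc : HasCompactSupport w := ρ.hasCompactSupport_normed
  have h1 := hwc.hasFDerivAt_convolution_left (ContinuousLinearMap.lsmul ℝ ℝ)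
    (hws.of_le (by simp)) hu x
  have hex : Integrable (fun t => (ContinuousLinearMap.precompL (Sp d)
      (ContinuousLinearMap.lsmul ℝ ℝ : ℝ →L[ℝ] F →L[ℝ] F)) (fderiv ℝ w t) (u (x - t))) volume :=
    (hwc.fderiv (𝕜 := ℝ)).convolutionExists_left _ (hws.continuous_fderiv (by simp)) hu x
  rw [mollify, h1.fderiv, convolution, ContinuousLinearMap.integral_apply hex]
  have hφ : IsTest fun y => w (x - y) := by
    refine ⟨hws.comp (contDiff_const.sub contDiff_id), ?_⟩
    exact hwc.comp_homeomorph (Homeomorph.subLeft x)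
  have hd : ∀ y, pderiv k (fun y => w (x - y)) y =
      -(fderiv ℝ w (x - y) (EuclideanSpace.single k 1)) := by
    intro y
    have := ((hws.differentiable (by simp) (x - y)).hasFDerivAt).comp y
      ((hasFDerivAt_const x y).sub (hasFDerivAt_id y))
    rw [pderiv, show (fun y => w (x - y)) = w ∘ (fun y => x - y) from rfl]
    erw [this.fderiv]
    simp
  have key := h _ hφ
  simp only [hd, neg_smul, integral_neg, neg_inj] at key
  have e2 : mollify ρ v x = ∫ y, w (x - y) • v y := by
    rw [mollify, convolution, ← integral_sub_left_eq_self _ volume x]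
    simp [hw]
  rw [e2, ← key, ← integral_sub_left_eq_self _ volume x]
  simp

end mollify

section cutoff

/-- A smooth cutoff function at scale `n + 1`. -/
def cutoff (d n : ℕ) (x : Sp d) : ℝ :=
  (⟨1, 2, one_pos, one_lt_two⟩ : ContDiffBump (0 : Sp d)) (((n : ℝ) + 1)⁻¹ • x)

lemma contDiff_cutoff (n : ℕ) : ContDiff ℝ (⊤ : ℕ∞) (cutoff d n) :=
  (ContDiffBump.contDiff _).comp (contDiff_const_smul _)

lemma hasCompactSupport_cutoff (n : ℕ) : HasCompactSupport (cutoff d n) :=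
  (ContDiffBump.hasCompactSupport _).comp_smul (by positivity)

lemma cutoff_nonneg (n : ℕ) (x : Sp d) : 0 ≤ cutoff d n x := ContDiffBump.nonneg _

lemma cutoff_le_one (n : ℕ) (x : Sp d) : cutoff d n x ≤ 1 := ContDiffBump.le_one _

lemma tendsto_cutoff (x : Sp d) :
    Filter.Tendsto (fun n => cutoff d n x) Filter.atTop (nhds 1) := by
  have h : Filter.Tendsto (fun n : ℕ => ((n : ℝ) + 1)⁻¹ • x) Filter.atTop (nhds (0 : Sp d)) := by
    have := (tendsto_one_div_add_atTop_nhds_zero_nat (𝕜 := ℝ)).smul_const x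
    simpa only [one_div, zero_smul] using this
  have hb := ((⟨1, 2, one_pos, one_lt_two⟩ : ContDiffBump (0 : Sp d)).continuous.tendsto 0).comp h
  have h1 : (⟨1, 2, one_pos, one_lt_two⟩ : ContDiffBump (0 : Sp d)) 0 = 1 :=
    ContDiffBump.one_of_mem_closedBall _ (by simp)
  rw [h1] at hb
  exact hb

/-- Dilating a fixed bump by `n + 1` divides its gradient by `n + 1`. This makes the commutator term
in the product rule vanish in the limit. -/
lemma exists_norm_fderiv_cutoff_le (d : ℕ) :
    ∃ C : ℝ, 0 ≤ C ∧ ∀ (n : ℕ) (x : Sp d), ‖fderiv ℝ (cutoff d n) x‖ ≤ C / ((n : ℝ) + 1) := by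
  set b : ContDiffBump (0 : Sp d) := ⟨1, 2, one_pos, one_lt_two⟩ with hb
  have hbs : ContDiff ℝ (⊤ : ℕ∞) b := b.contDiff
  obtain ⟨C, hC⟩ := (hbs.continuous_fderiv (by simp)).bounded_above_of_compact_support
    (b.hasCompactSupport.fderiv (𝕜 := ℝ))
  refine ⟨C, (norm_nonneg _).trans (hC 0), fun n x => ?_⟩
  have hpos : (0 : ℝ) < (n : ℝ) + 1 := by positivity
  have : cutoff d n = fun x => b (((n : ℝ) + 1)⁻¹ • x) := rfl
  rw [this, fderiv_comp_smul, norm_smul, Real.norm_of_nonneg (by positivity), div_eq_inv_mul]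
  gcongr
  exact hC _

variable {F : Type*} [NormedAddCommGroup F] [NormedSpace ℝ F]

lemma tendsto_eLpNorm_cutoff_smul_sub {f : Sp d → F} (hf : MemLp f 2 volume) :
    Filter.Tendsto (fun n => eLpNorm (fun x => cutoff d n x • f x - f x) 2 volume)
      Filter.atTop (nhds 0) := by
  have h2 : ∀ n, eLpNorm (fun x => cutoff d n x • f x - f x) 2 volume =
      (∫⁻ x, ‖cutoff d n x • f x - f x‖ₑ ^ 2) ^ (1 / 2 : ℝ) := fun n => by
    rw [← eLpNorm_two_sq, ← ENNReal.rpow_natCast, ← ENNReal.rpow_mul]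
    norm_num
  simp only [h2]
  rw [show (0 : ENNReal) = (∫⁻ _ : Sp d, 0) ^ (1 / 2 : ℝ) by simp]
  refine (ENNReal.continuous_rpow_const.tendsto _).comp ?_
  refine tendsto_lintegral_of_dominated_convergence' (fun x => ‖f x‖ₑ ^ 2) (fun n => ?_)
    (fun n => Filter.Eventually.of_forall fun x => ?_) ?_
    (Filter.Eventually.of_forall fun x => ?_)
  · exact ((((contDiff_cutoff n).continuous.aestronglyMeasurable.smul hf.1).sub
      hf.1).enorm).pow_const _
  · dsimp only
    gcongr
    have : cutoff d n x • f x - f x = (cutoff d n x - 1) • f x := by rw [sub_smul, one_smul]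
    rw [this, enorm_smul]
    refine (mul_le_mul_left ?_ _).trans_eq (one_mul _)
    rw [← ofReal_norm, Real.norm_eq_abs, ENNReal.ofReal_le_one, abs_le]
    constructor <;> linarith [cutoff_nonneg n x, cutoff_le_one n x]
  · rw [← eLpNorm_two_sq]
    exact (ENNReal.pow_lt_top hf.2).ne
  · have := ((tendsto_cutoff x).smul_const (f x)).sub_const (f x)
    rw [one_smul, sub_self] at this
    have := (ENNReal.continuous_pow 2).tendsto _ |>.comp this.enorm
    simpa [Function.comp_def] using this

end cutoff

lemma exists_smooth_memLp_approx {U : H1 d N} {ε : ENNReal} (hε : 0 < ε) :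
    ∃ f : Sp d → Cn N, ContDiff ℝ (⊤ : ℕ∞) f ∧
      eLpNorm (fun x => f x - H1.fn U x) 2 volume ≤ ε ∧
      ∀ k, eLpNorm (fun x => vpderiv k f x - H1.partialFn U k x) 2 volume ≤ ε := by
  have h0 := (tendsto_eLpNorm_translate_sub U.1.1).eventually (ge_mem_nhds hε)
  have h1 := Filter.eventually_all.2 fun k =>
    (tendsto_eLpNorm_translate_sub (U.1.2 k)).eventually (ge_mem_nhds hε)
  obtain ⟨δ, hδ, H⟩ := Metric.eventually_nhds_iff.1 (h0.and h1)
  let ρ : ContDiffBump (0 : Sp d) := ⟨δ / 2, δ, half_pos hδ, half_lt_self hδ⟩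
  have hl : LocallyIntegrable (H1.fn U) volume := (H1.memLp_fn U).locallyIntegrable (by norm_num)
  refine ⟨mollify ρ (H1.fn U), contDiff_mollify ρ hl, ?_, fun k => ?_⟩
  · exact eLpNorm_mollify_sub_le ρ hl (Lp.stronglyMeasurable _)
      fun y hy => (H (by simpa using hy)).1
  · have : vpderiv k (mollify ρ (H1.fn U)) = mollify ρ (H1.partialFn U k) :=
      funext fun x => fderiv_mollify ρ hl (H1.isWeakPartial U k) x
    rw [this]
    exact eLpNorm_mollify_sub_le ρ ((H1.memLp_partialFn U k).locallyIntegrable (by norm_num))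
      (Lp.stronglyMeasurable _) fun y hy => (H (by simpa using hy)).2 k

lemma vpderiv_cutoff_smul {f : Sp d → Cn N} (hf : ContDiff ℝ (⊤ : ℕ∞) f) (n : ℕ) (k : Fin d)
    (x : Sp d) : vpderiv k (fun x => cutoff d n x • f x) x =
      cutoff d n x • vpderiv k f x + pderiv k (cutoff d n) x • f x := by
  have h := ((contDiff_cutoff n).differentiable (by simp) x).hasFDerivAt.smul
    (hf.differentiable (by simp) x).hasFDerivAt
  rw [vpderiv]
  erw [h.fderiv]
  simp [vpderiv, pderiv]

/-- Truncate by `χ_n`: the error `∂(χ_n f) - ∂f` is `(χ_n - 1) ∂f`, small by dominated convergence,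
plus `(∂χ_n) f`, at most `C ‖f‖₂ / (n + 1)`. -/
lemma exists_isTestVec_approx_of_smooth {f : Sp d → Cn N} (hf : ContDiff ℝ (⊤ : ℕ∞) f)
    (h0 : MemLp f 2 volume) (h1 : ∀ k, MemLp (vpderiv k f) 2 volume) {ε : ENNReal} (hε : 0 < ε) :
    ∃ f' : Sp d → Cn N, IsTestVec f' ∧ eLpNorm (fun x => f' x - f x) 2 volume ≤ ε ∧
      ∀ k, eLpNorm (fun x => vpderiv k f' x - vpderiv k f x) 2 volume ≤ ε := by
  obtain ⟨C, hC, hCb⟩ := exists_norm_fderiv_cutoff_le d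
  have hk : ∀ k, Filter.Tendsto
      (fun n => eLpNorm (fun x => vpderiv k (fun x => cutoff d n x • f x) x - vpderiv k f x) 2
        volume) Filter.atTop (nhds 0) := by
    intro k
    have hA := tendsto_eLpNorm_cutoff_smul_sub (h1 k)
    have hB : Filter.Tendsto (fun n : ℕ => ENNReal.ofReal (C / ((n : ℝ) + 1)) *
        eLpNorm f 2 volume) Filter.atTop (nhds 0) := by
      have h : Filter.Tendsto (fun n : ℕ => C / ((n : ℝ) + 1)) Filter.atTop (nhds 0) := by
        simpa [div_eq_mul_inv] using
          (tendsto_one_div_add_atTop_nhds_zero_nat (𝕜 := ℝ)).const_mul C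
      have := ENNReal.Tendsto.mul_const (b := eLpNorm f 2 volume)
        (ENNReal.tendsto_ofReal h) (Or.inr h0.2.ne)
      simpa using this
    refine tendsto_of_tendsto_of_tendsto_of_le_of_le tendsto_const_nhds
      (by simpa using hA.add hB) (fun n => zero_le) fun n => ?_
    have e : (fun x => vpderiv k (fun x => cutoff d n x • f x) x - vpderiv k f x) =
        (fun x => cutoff d n x • vpderiv k f x - vpderiv k f x) +
          fun x => pderiv k (cutoff d n) x • f x := by
      funext x
      rw [vpderiv_cutoff_smul hf, Pi.add_apply]
      abel
    have hc : Continuous (pderiv k (cutoff d n)) :=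
      ((contDiff_cutoff n).continuous_fderiv (by simp)).clm_apply continuous_const
    dsimp only
    rw [e]
    refine (eLpNorm_add_le ?_ ?_ (by norm_num)).trans (add_le_add le_rfl ?_)
    · exact ((contDiff_cutoff n).continuous.aestronglyMeasurable.smul (h1 k).1).sub (h1 k).1
    · exact hc.aestronglyMeasurable.smul h0.1
    · refine eLpNorm_le_mul_eLpNorm_of_ae_le_mul (Filter.Eventually.of_forall fun x => ?_) 2
      rw [norm_smul]
      gcongr
      refine ((fderiv ℝ (cutoff d n) x).le_opNorm _).trans ?_
      simpa using hCb n x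
  obtain ⟨n, hn0, hn1⟩ := (((tendsto_eLpNorm_cutoff_smul_sub h0).eventually
    (ge_mem_nhds hε)).and (Filter.eventually_all.2 fun k =>
      (hk k).eventually (ge_mem_nhds hε))).exists
  exact ⟨fun x => cutoff d n x • f x, ⟨(contDiff_cutoff n).smul hf,
    (hasCompactSupport_cutoff n).smul_right⟩, hn0, hn1⟩

/-- Smooth compactly supported functions are dense in `H¹`. -/
theorem exists_testElt_sub_enorm_le (U : H1 d N) {ε : ENNReal} (hε : 0 < ε) :
    ∃ (f : Sp d → Cn N) (hf : IsTestVec f), ‖testElt f hf - U‖ₑ ≤ ε := by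
  -- A finite `ε` is needed below to deduce that the mollified function and its derivatives are in
  -- `L²`.
  wlog hεt : ε ≠ ⊤ generalizing ε
  · obtain ⟨f, hf, h⟩ := this (ε := 1) one_pos ENNReal.one_ne_top
    exact ⟨f, hf, by simp [not_not.1 hεt]⟩
  have hε2 : 0 < ε / 2 := ENNReal.half_pos hε.ne'
  have hε2t : ε / 2 < ⊤ := ENNReal.div_lt_top hεt (by norm_num)
  obtain ⟨f, hfs, hf0, hf1⟩ := exists_smooth_memLp_approx (U := U) hε2
  have hcv : ∀ k, Continuous (vpderiv k f) := fun k =>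
    (hfs.continuous_fderiv (by simp)).clm_apply continuous_const
  have m0 : MemLp f 2 volume := by
    have : MemLp (fun x => f x - H1.fn U x) 2 volume :=
      ⟨hfs.continuous.aestronglyMeasurable.sub (H1.memLp_fn U).1, hf0.trans_lt hε2t⟩
    simpa [Pi.add_def] using this.add (H1.memLp_fn U)
  have m1 : ∀ k, MemLp (vpderiv k f) 2 volume := fun k => by
    have : MemLp (fun x => vpderiv k f x - H1.partialFn U k x) 2 volume :=
      ⟨(hcv k).aestronglyMeasurable.sub (H1.memLp_partialFn U k).1, (hf1 k).trans_lt hε2t⟩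
    simpa [Pi.add_def] using this.add (H1.memLp_partialFn U k)
  obtain ⟨g, hg, hg0, hg1⟩ := exists_isTestVec_approx_of_smooth hfs m0 m1 hε2
  have key : ∀ {a b c : Sp d → Cn N}, AEStronglyMeasurable a volume →
      AEStronglyMeasurable b volume → AEStronglyMeasurable c volume →
      eLpNorm (fun x => a x - b x) 2 volume ≤ ε / 2 →
      eLpNorm (fun x => b x - c x) 2 volume ≤ ε / 2 →
      eLpNorm (fun x => a x - c x) 2 volume ≤ ε := by
    intro a b c ha hb hc hab hbc
    have e : (fun x => a x - c x) = (fun x => a x - b x) + fun x => b x - c x := by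
      funext x; simp
    rw [e, ← ENNReal.add_halves ε]
    exact (eLpNorm_add_le (ha.sub hb) (hb.sub hc) (by norm_num)).trans (add_le_add hab hbc)
  refine ⟨g, hg, H1.enorm_le ?_ fun k => ?_⟩
  · refine (eLpNorm_congr_ae (g := fun x => g x - H1.fn U x) ?_).trans_le
      (key hg.memLp.1 m0.1 (H1.memLp_fn U).1 hg0 hf0)
    filter_upwards [H1.fn_sub (testElt g hg) U, fn_testElt hg] with x h1 h2
    rw [h1, h2]
  · refine (eLpNorm_congr_ae (g := fun x => vpderiv k g x - H1.partialFn U k x) ?_).trans_le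
      (key (hg.memLp_vpderiv k).1 (m1 k).1 (H1.memLp_partialFn U k).1 (hg1 k) (hf1 k))
    filter_upwards [H1.partialFn_sub (testElt g hg) U k, partialFn_testElt hg k] with x h1 h2
    rw [h1, h2]

end

/-! ### The Sobolev embedding, for test functions and then for all of `H¹`. -/

noncomputable section

variable {d N : ℕ}

/-- The inequality `∫ |f|^q ≤ C ‖f‖_{H¹}^q` for smooth compactly supported functions. -/
def SobolevBound (d N : ℕ) (q : ℝ) : Prop :=
  ∃ C : NNReal, ∀ f : Sp d → Cn N, IsTestVec f → ∀ K : NNReal, eLpNorm f 2 volume ≤ K →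
    eLpNorm (fderiv ℝ f) 2 volume ≤ K → ∫⁻ x, ‖f x‖ₑ ^ q ≤ C * (K : ENNReal) ^ q

lemma sobolevBound_two (d N : ℕ) : SobolevBound d N 2 := by
  refine ⟨1, fun f _ K h _ => ?_⟩
  simp only [ENNReal.rpow_two]
  rw [← eLpNorm_two_sq, ENNReal.coe_one, one_mul]
  exact pow_le_pow_left' h 2

/-- Interpolation without Hölder: `a^r ≤ K^{r-2} a² + K^{r-q} a^q`, the first term dominating for `a
≤ K` and the second for `a ≥ K`. The powers of `K` restore the right homogeneity after integration.
-/
lemma SobolevBound.mono {q r : ℝ} (h : SobolevBound d N q) (h2 : 2 ≤ r) (hr : r ≤ q) :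
    SobolevBound d N r := by
  obtain ⟨C, hC⟩ := h
  refine ⟨1 + C, fun f hf K hK0 hK1 => ?_⟩
  have hr0 : 0 < r := by linarith
  have hmf : Measurable fun x => ‖f x‖ₑ := hf.1.continuous.measurable.enorm
  -- The exponent `r - q` may be negative, so `K = 0` is treated apart; then `f` vanishes almost
  -- everywhere.
  rcases eq_or_ne K 0 with rfl | hK
  · have : f =ᵐ[volume] 0 := by
      rw [← eLpNorm_eq_zero_iff hf.memLp.1 two_ne_zero]
      simpa using hK0
    rw [lintegral_congr_ae (g := fun _ => 0)]
    · simp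
    · filter_upwards [this] with x hx
      simp [hx, hr0]
  have hKpos : 0 < K := pos_iff_ne_zero.2 hK
  have pt : ∀ a : NNReal, a ^ r ≤ K ^ (r - 2) * a ^ (2 : ℝ) + K ^ (r - q) * a ^ q := by
    intro a
    rcases eq_or_ne a 0 with rfl | ha
    · rw [NNReal.zero_rpow hr0.ne']; exact zero_le
    have hapos : 0 < a := pos_iff_ne_zero.2 ha
    rcases le_total a K with hle | hle
    · calc a ^ r = a ^ (r - 2) * a ^ (2 : ℝ) := by rw [← NNReal.rpow_add ha]; simp
        _ ≤ K ^ (r - 2) * a ^ (2 : ℝ) := by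
          gcongr
        _ ≤ _ := le_self_add
    · calc a ^ r = a ^ (r - q) * a ^ q := by rw [← NNReal.rpow_add ha]; simp
        _ ≤ K ^ (r - q) * a ^ q := by
          refine mul_le_mul' ?_ le_rfl
          exact_mod_cast Real.rpow_le_rpow_of_nonpos (NNReal.coe_pos.2 hKpos)
            (NNReal.coe_le_coe.2 hle) (by linarith : r - q ≤ 0)
        _ ≤ _ := le_add_self
  have hq0 : 0 ≤ q := by linarith
  have ptE : ∀ x, ‖f x‖ₑ ^ r ≤ (K ^ (r - 2) : NNReal) * ‖f x‖ₑ ^ (2 : ℝ) +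
      (K ^ (r - q) : NNReal) * ‖f x‖ₑ ^ q := by
    intro x
    have := pt ‖f x‖₊
    rw [enorm_eq_nnnorm, ← ENNReal.coe_rpow_of_nonneg _ hr0.le,
      ← ENNReal.coe_rpow_of_nonneg _ zero_le_two, ← ENNReal.coe_rpow_of_nonneg _ hq0]
    exact_mod_cast this
  calc ∫⁻ x, ‖f x‖ₑ ^ r
      ≤ ∫⁻ x, ((K ^ (r - 2) : NNReal) * ‖f x‖ₑ ^ (2 : ℝ) +
          (K ^ (r - q) : NNReal) * ‖f x‖ₑ ^ q) := lintegral_mono ptE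
    _ = (K ^ (r - 2) : NNReal) * (∫⁻ x, ‖f x‖ₑ ^ (2 : ℝ)) +
          (K ^ (r - q) : NNReal) * ∫⁻ x, ‖f x‖ₑ ^ q := by
        rw [lintegral_add_left ((hmf.pow_const _).const_mul _),
          lintegral_const_mul _ (hmf.pow_const _), lintegral_const_mul _ (hmf.pow_const _)]
    _ ≤ (K ^ (r - 2) : NNReal) * (K : ENNReal) ^ (2 : ℝ) +
          (K ^ (r - q) : NNReal) * (C * (K : ENNReal) ^ q) := by
        gcongr
        · simp only [ENNReal.rpow_two]
          rw [← eLpNorm_two_sq]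
          exact pow_le_pow_left' hK0 2
        · exact hC f hf K hK0 hK1
    _ = ((1 + C : NNReal) : ENNReal) * (K : ENNReal) ^ r := by
        rw [← ENNReal.coe_rpow_of_nonneg _ hr0.le,
          ← ENNReal.coe_rpow_of_nonneg _ zero_le_two, ← ENNReal.coe_rpow_of_nonneg _ hq0]
        norm_cast
        have e1 : K ^ (r - 2) * K ^ (2 : ℕ) = K ^ r := by
          rw [← NNReal.rpow_natCast, ← NNReal.rpow_add hK]; simp
        have e2 : K ^ (r - q) * K ^ q = K ^ r := by rw [← NNReal.rpow_add hK]; simp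
        rw [e1, mul_left_comm, e2]
        ring

/-- The Gagliardo–Nirenberg–Sobolev inequality with `1/q = 1/2 - 1/d`; only the gradient bound
enters. -/
lemma sobolevBound_critical (N : ℕ) (hd : 3 ≤ d) :
    SobolevBound d N (2 * (d : ℝ) / ((d : ℝ) - 2)) := by
  have hd' : (3 : ℝ) ≤ d := by exact_mod_cast hd
  have hq0 : 0 < 2 * (d : ℝ) / ((d : ℝ) - 2) := by
    apply div_pos <;> linarith
  obtain ⟨q, hq⟩ : ∃ q : NNReal, (q : ℝ) = 2 * (d : ℝ) / ((d : ℝ) - 2) := ⟨⟨_, hq0.le⟩, rfl⟩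
  rw [← hq] at hq0 ⊢
  refine ⟨(SNormLESNormFDerivOfEqConst (Cn N) (volume : Measure (Sp d)) 2) ^ (q : ℝ),
    fun f hf K _ hK => ?_⟩
  have h := eLpNorm_le_eLpNorm_fderiv_of_eq (volume : Measure (Sp d)) (hf.1.of_le (by simp)) hf.2
    (p := 2) (p' := q) (by norm_num) (by simp; omega) (by
      rw [hq, finrank_euclideanSpace_fin, inv_div]
      have : (d : ℝ) - 2 ≠ 0 := by linarith
      push_cast
      field_simp)
  rw [← eLpNorm_nnreal_pow_eq_lintegral (by exact_mod_cast hq0.ne'),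
    ENNReal.coe_rpow_of_nonneg _ hq0.le, ← ENNReal.mul_rpow_of_nonneg _ _ hq0.le]
  gcongr
  refine h.trans ?_
  gcongr
  · exact le_rfl
  · simpa using hK

lemma sq_lintegral_mul_le_mul {α : Type*} {m : MeasurableSpace α} {μ : Measure α}
    {a b : α → ENNReal} (ha : AEMeasurable a μ) (hb : AEMeasurable b μ) :
    (∫⁻ t, a t * b t ∂μ) ^ 2 ≤ (∫⁻ t, a t ^ 2 ∂μ) * ∫⁻ t, b t ^ 2 ∂μ := by
  have h := ENNReal.lintegral_mul_le_Lp_mul_Lq μ Real.HolderConjugate.two_two ha hb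
  have e2 : ∀ a : ENNReal, (a ^ (1 / 2 : ℝ)) ^ (2 : ℝ) = a := fun a => by
    rw [← ENNReal.rpow_mul]; norm_num
  refine (pow_le_pow_left' h 2).trans_eq ?_
  rw [mul_pow, ← ENNReal.rpow_natCast, ← ENNReal.rpow_natCast, Nat.cast_ofNat, e2, e2]
  simp only [ENNReal.rpow_two]

lemma IsTestVec.measurable_enorm_fderiv {f : Sp d → Cn N} (hf : IsTestVec f) :
    Measurable fun x => ‖fderiv ℝ f x‖ₑ :=
  (hf.1.continuous_fderiv (by simp)).enorm.measurable

/-- Induction raising the exponent by 2. The planar embedding of `W^{1,1}` in `L²`, applied to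
`|f|^{n+2}`, bounds `∫ |f|^{2(n+2)}` by a multiple of `(∫ |f|^{n+1} |∇f|)²`. Cauchy–Schwarz splits
this into `∫ |f|^{2(n+1)}`, controlled by induction, and `∫ |∇f|²`. -/
lemma sobolevBound_dim_two (N n : ℕ) : SobolevBound 2 N (2 * ((n : ℝ) + 1)) := by
  induction n with
  | zero => simpa using sobolevBound_two 2 N
  | succ n ih =>
    obtain ⟨C, hC⟩ := ih
    set c := eLpNormLESNormFDerivOneConst (volume : Measure (Sp 2)) 2 with hc
    refine ⟨c ^ 2 * ((n : NNReal) + 2) ^ 2 * C, fun f hf K hK0 hK1 => ?_⟩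
    have hf1 : ContDiff ℝ 1 f := hf.1.of_le (by simp)
    set γ : NNReal := (n : NNReal) + 2 with hγ
    have h1γ : (1 : NNReal) < γ := by
      rw [hγ]; exact lt_of_lt_of_le one_lt_two le_add_self
    have hu : ContDiff ℝ 1 fun x => ‖f x‖ ^ (γ : ℝ) := hf1.norm_rpow (by exact_mod_cast h1γ)
    have hus : HasCompactSupport fun x => ‖f x‖ ^ (γ : ℝ) :=
      hf.2.comp_left (g := fun z => ‖z‖ ^ (γ : ℝ)) (by
        have : (γ : ℝ) ≠ 0 := by positivity
        simp [Real.zero_rpow this])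
    have h := eLpNorm_le_eLpNorm_fderiv_one (volume : Measure (Sp 2)) hu hus (p := 2) (by
      rw [finrank_euclideanSpace_fin]
      exact_mod_cast NNReal.HolderConjugate.two_two)
    have e1 : ∀ x, ‖(‖f x‖ ^ (γ : ℝ))‖ₑ ^ 2 = ‖f x‖ₑ ^ (2 * (((n + 1 : ℕ) : ℝ) + 1)) := by
      intro x
      rw [Real.enorm_rpow_of_nonneg (norm_nonneg _) (by positivity), enorm_norm,
        ← ENNReal.rpow_natCast, ← ENNReal.rpow_mul]
      congr 1
      rw [hγ]; push_cast; ring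
    have hme := hf.measurable_enorm_fderiv
    have hmf : Measurable fun x => ‖f x‖ₑ := hf.1.continuous.measurable.enorm
    calc ∫⁻ x, ‖f x‖ₑ ^ (2 * (((n + 1 : ℕ) : ℝ) + 1))
        = eLpNorm (fun x => ‖f x‖ ^ (γ : ℝ)) 2 volume ^ 2 := by
          rw [eLpNorm_two_sq]; exact lintegral_congr fun x => (e1 x).symm
      _ ≤ (c * ∫⁻ x, γ * (‖f x‖ₑ ^ ((n : ℝ) + 1) * ‖fderiv ℝ f x‖ₑ)) ^ 2 := by
          refine pow_le_pow_left' (h.trans ?_) 2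
          rw [eLpNorm_one_eq_lintegral_enorm]
          gcongr with x
          · exact le_rfl
          refine (enorm_fderiv_norm_rpow_le (hf1.differentiable (by simp)) h1γ).trans_eq ?_
          rw [mul_assoc]
          congr 3
          rw [hγ]; push_cast; ring
      _ = c ^ 2 * γ ^ 2 * (∫⁻ x, ‖f x‖ₑ ^ ((n : ℝ) + 1) * ‖fderiv ℝ f x‖ₑ) ^ 2 := by
          have hm : Measurable fun x => ‖f x‖ₑ ^ ((n : ℝ) + 1) * ‖fderiv ℝ f x‖ₑ :=
            (hmf.pow_const _).mul hme
          rw [lintegral_const_mul _ hm]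
          ring
      _ ≤ c ^ 2 * γ ^ 2 * ((C * (K : ENNReal) ^ (2 * ((n : ℝ) + 1))) * K ^ 2) := by
          gcongr
          refine (sq_lintegral_mul_le_mul (hmf.pow_const _).aemeasurable
            hme.aemeasurable).trans ?_
          refine mul_le_mul' ?_ ?_
          · refine le_trans (le_of_eq (lintegral_congr fun x => ?_)) (hC f hf K hK0 hK1)
            rw [← ENNReal.rpow_natCast, ← ENNReal.rpow_mul]
            congr 1
            push_cast; ring
          · rw [← eLpNorm_two_sq]
            exact pow_le_pow_left' hK1 2
      _ = _ := by
          have : (K : ENNReal) ^ (2 * (((n + 1 : ℕ) : ℝ) + 1)) =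
              (K : ENNReal) ^ (2 * ((n : ℝ) + 1)) * K ^ 2 := by
            rw [← ENNReal.rpow_two, ← ENNReal.rpow_add_of_nonneg _ _ (by positivity) zero_le_two]
            congr 1
            push_cast; ring
          rw [this]
          push_cast
          ring

/-- The fundamental theorem of calculus on a half-line for `|f|²`, whose derivative is at most `2
|f| |f'|`. A measure preserving isometry identifies `Sp 1` with `ℝ`. -/
lemma enorm_sq_le_of_dim_one {f : Sp 1 → Cn N} (hf : IsTestVec f) (x : Sp 1) :
    ‖f x‖ₑ ^ 2 ≤ 2 * ∫⁻ y, ‖f y‖ₑ * ‖fderiv ℝ f y‖ₑ := by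
  let e : ℝ ≃ₗᵢ[ℝ] Sp 1 := (OrthonormalBasis.singleton (Fin 1) ℝ).repr
  have hf1 : ContDiff ℝ 1 f := hf.1.of_le (by simp)
  have hg1 : ContDiff ℝ 1 (f ∘ e) := hf1.comp e.toContinuousLinearEquiv.contDiff
  have hgs : HasCompactSupport (f ∘ e) := hf.2.comp_homeomorph e.toHomeomorph
  have h2 : ((2 : NNReal) : ℝ) = 2 := rfl
  have hu : ContDiff ℝ 1 fun t => ‖(f ∘ e) t‖ ^ ((2 : NNReal) : ℝ) :=
    hg1.norm_rpow (by norm_num)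
  have hus : HasCompactSupport fun t => ‖(f ∘ e) t‖ ^ ((2 : NNReal) : ℝ) :=
    hgs.comp_left (g := fun z => ‖z‖ ^ ((2 : NNReal) : ℝ)) (by simp)
  have h := hus.enorm_le_lintegral_Ici_deriv hu (e.symm x)
  have hl : ‖‖(f ∘ e) (e.symm x)‖ ^ ((2 : NNReal) : ℝ)‖ₑ = ‖f x‖ₑ ^ 2 := by
    rw [Real.enorm_rpow_of_nonneg (norm_nonneg _) (by norm_num), enorm_norm, h2,
      ENNReal.rpow_two]
    simp
  rw [hl] at h
  have hme := hf.measurable_enorm_fderiv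
  have hmf : Measurable fun x => ‖f x‖ₑ := hf.1.continuous.measurable.enorm
  calc ‖f x‖ₑ ^ 2 ≤ _ := h
    _ ≤ ∫⁻ t, ‖deriv (fun t => ‖(f ∘ e) t‖ ^ ((2 : NNReal) : ℝ)) t‖ₑ :=
        setLIntegral_le_lintegral _ _
    _ ≤ ∫⁻ t, 2 * (‖f (e t)‖ₑ * ‖fderiv ℝ f (e t)‖ₑ) := by
        refine lintegral_mono fun t => ?_
        have hde : ‖deriv (fun t => ‖(f ∘ e) t‖ ^ ((2 : NNReal) : ℝ)) t‖ₑ =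
            ‖fderiv ℝ (fun t => ‖(f ∘ e) t‖ ^ ((2 : NNReal) : ℝ)) t‖ₑ := by
          rw [← ofReal_norm, ← ofReal_norm, norm_deriv_eq_norm_fderiv]
        rw [hde]
        refine (enorm_fderiv_norm_rpow_le (hg1.differentiable (by simp)) (by norm_num)).trans ?_
        rw [mul_assoc]
        have : ((2 : NNReal) : ℝ) - 1 = 1 := by norm_num
        rw [this, ENNReal.rpow_one, ENNReal.coe_ofNat]
        gcongr
        · exact le_rfl
        have hfd := (hf1.differentiable (by simp) (e t)).hasFDerivAt.comp t
          e.toContinuousLinearEquiv.hasFDerivAt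
        erw [hfd.fderiv]
        rw [← ofReal_norm, ← ofReal_norm]
        refine ENNReal.ofReal_le_ofReal ?_
        refine (ContinuousLinearMap.opNorm_comp_le _ _).trans ?_
        refine mul_le_of_le_one_right (norm_nonneg _) ?_
        exact ContinuousLinearMap.opNorm_le_bound _ zero_le_one fun s => by simp
    _ = 2 * ∫⁻ t, ‖f (e t)‖ₑ * ‖fderiv ℝ f (e t)‖ₑ := by
        rw [lintegral_const_mul]
        exact (hmf.mul hme).comp e.continuous.measurable
    _ = _ := by
        have hm : Measurable fun y => ‖f y‖ₑ * ‖fderiv ℝ f y‖ₑ := hmf.mul hme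
        rw [e.measurePreserving.lintegral_comp hm]

/-- In dimension one `|f| ≤ 2K` everywhere, so `∫ |f|^r ≤ (2K)^{r-2} ∫ |f|²`. -/
lemma sobolevBound_dim_one (N : ℕ) {r : ℝ} (hr : 2 ≤ r) : SobolevBound 1 N r := by
  refine ⟨2 ^ (r - 2), fun f hf K hK0 hK1 => ?_⟩
  have hme := hf.measurable_enorm_fderiv
  have hmf : Measurable fun x => ‖f x‖ₑ := hf.1.continuous.measurable.enorm
  have hi : ∫⁻ y, ‖f y‖ₑ * ‖fderiv ℝ f y‖ₑ ≤ (K : ENNReal) ^ 2 := by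
    rw [← ENNReal.pow_le_pow_left_iff two_ne_zero]
    refine (sq_lintegral_mul_le_mul hmf.aemeasurable hme.aemeasurable).trans ?_
    rw [← eLpNorm_two_sq, ← eLpNorm_two_sq, sq ((K : ENNReal) ^ 2)]
    exact mul_le_mul' (pow_le_pow_left' hK0 2) (pow_le_pow_left' hK1 2)
  have hb : ∀ x, ‖f x‖ₑ ≤ 2 * (K : ENNReal) := by
    intro x
    rw [← ENNReal.pow_le_pow_left_iff two_ne_zero]
    calc ‖f x‖ₑ ^ 2 ≤ 2 * (K : ENNReal) ^ 2 := (enorm_sq_le_of_dim_one hf x).trans (by gcongr)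
      _ ≤ 2 ^ 2 * (K : ENNReal) ^ 2 := by gcongr; norm_num
      _ = _ := by ring
  calc ∫⁻ x, ‖f x‖ₑ ^ r ≤ ∫⁻ x, (2 * (K : ENNReal)) ^ (r - 2) * ‖f x‖ₑ ^ 2 := by
        refine lintegral_mono fun x => ?_
        dsimp only
        rw [← ENNReal.rpow_two]
        calc ‖f x‖ₑ ^ r = ‖f x‖ₑ ^ (r - 2) * ‖f x‖ₑ ^ (2 : ℝ) := by
              rw [← ENNReal.rpow_add_of_nonneg _ _ (by linarith) zero_le_two]; simp
          _ ≤ _ := by exact mul_le_mul' (ENNReal.rpow_le_rpow (hb x) (by linarith)) le_rfl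
    _ = (2 * (K : ENNReal)) ^ (r - 2) * eLpNorm f 2 volume ^ 2 := by
        rw [lintegral_const_mul _ (hmf.pow_const _), eLpNorm_two_sq]
    _ ≤ (2 * (K : ENNReal)) ^ (r - 2) * (K : ENNReal) ^ 2 := by gcongr
    _ = _ := by
        rw [ENNReal.mul_rpow_of_nonneg _ _ (by linarith), mul_assoc, ← ENNReal.rpow_two,
          ← ENNReal.rpow_add_of_nonneg _ _ (by linarith) zero_le_two,
          ENNReal.coe_rpow_of_nonneg _ (by linarith)]
        simp

theorem sobolevBound (N : ℕ) (hd : 1 ≤ d) {r : ℝ} (h2 : 2 ≤ r)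
    (hr : 3 ≤ d → r ≤ 2 * (d : ℝ) / ((d : ℝ) - 2)) : SobolevBound d N r := by
  rcases Nat.lt_or_ge d 3 with h3 | h3
  · obtain rfl | rfl : d = 1 ∨ d = 2 := by omega
    · exact sobolevBound_dim_one N h2
    · obtain ⟨n, hn⟩ := exists_nat_ge r
      exact (sobolevBound_dim_two N n).mono h2 (by linarith)
  · exact (sobolevBound_critical N h3).mono h2 (hr h3)

lemma IsTestVec.eLpNorm_fderiv_le {f : Sp d → Cn N} (hf : IsTestVec f) {K : ENNReal}
    (h : ∀ k, eLpNorm (vpderiv k f) 2 volume ≤ K) : eLpNorm (fderiv ℝ f) 2 volume ≤ d * K := by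
  have pt : ∀ x, ‖fderiv ℝ f x‖ ≤ ∑ k, ‖vpderiv k f x‖ := by
    intro x
    refine ContinuousLinearMap.opNorm_le_bound _ (Finset.sum_nonneg fun _ _ => norm_nonneg _)
      fun v => ?_
    have hv : v = ∑ k, v k • EuclideanSpace.single k (1 : ℝ) := by
      ext i; simp [Finset.sum_apply, Pi.single_apply]
    conv_lhs => rw [hv, map_sum]
    rw [Finset.sum_mul]
    refine (norm_sum_le _ _).trans (Finset.sum_le_sum fun k _ => ?_)
    rw [map_smul, norm_smul, mul_comm]
    exact mul_le_mul_of_nonneg_left (PiLp.norm_apply_le v k) (norm_nonneg _)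
  calc eLpNorm (fderiv ℝ f) 2 volume
      ≤ eLpNorm (∑ k, fun x => ‖vpderiv k f x‖) 2 volume := by
        refine eLpNorm_mono_real fun x => ?_
        simpa [Finset.sum_apply] using pt x
    _ ≤ ∑ k, eLpNorm (fun x => ‖vpderiv k f x‖) 2 volume :=
        eLpNorm_sum_le (fun k _ => (hf.memLp_vpderiv k).1.norm) (by norm_num)
    _ ≤ ∑ _k : Fin d, K := Finset.sum_le_sum fun k _ => by
        rw [eLpNorm_norm]; exact h k
    _ = d * K := by simp

/-- The Sobolev embedding `H¹ ⊂ L^r` for `2 ≤ r ≤ 2^*`, `r < ∞`. -/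
theorem exists_lintegral_rpow_le (N : ℕ) (hd : 1 ≤ d) {r : ℝ} (h2 : 2 ≤ r)
    (hr : 3 ≤ d → r ≤ 2 * (d : ℝ) / ((d : ℝ) - 2)) :
    ∃ C : NNReal, ∀ U : H1 d N, ∫⁻ x, ‖H1.fn U x‖ₑ ^ r ≤ C * ‖U‖ₑ ^ r := by
  obtain ⟨C, hC⟩ := sobolevBound N hd h2 hr
  have hr0 : 0 < r := by linarith
  -- The factor `d` bounds the full gradient by its partials, and the factor 2 bounds the norm of
  -- the approximants by that of `U`.
  refine ⟨C * (d * 2) ^ r, fun U => ?_⟩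
  rcases eq_or_ne U 0 with rfl | hU
  · rw [lintegral_congr_ae (g := fun _ => 0)]
    · simp
    · filter_upwards [H1.fn_zero (d := d) (N := N)] with x hx
      simp [hx, hr0]
  have hUpos : 0 < ‖U‖ₑ := by
    rw [← ofReal_norm, ENNReal.ofReal_pos]; exact norm_pos_iff.2 hU
  -- Closeness `‖U‖` keeps the approximants below `2 ‖U‖`, so the bound stays homogeneous; closeness
  -- `1/(n+1)` gives convergence.
  have happ : ∀ n : ℕ, ∃ (f : Sp d → Cn N) (hf : IsTestVec f),
      ‖testElt f hf - U‖ₑ ≤ min ‖U‖ₑ ((n : ENNReal) + 1)⁻¹ := fun n =>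
    exists_testElt_sub_enorm_le U (lt_min hUpos (by simp))
  choose f hf hfU using happ
  have hnorm : ∀ n, ‖testElt (f n) (hf n)‖ₑ ≤ 2 * ‖U‖ₑ := fun n => by
    calc ‖testElt (f n) (hf n)‖ₑ ≤ ‖testElt (f n) (hf n) - U‖ₑ + ‖U‖ₑ := by
          simp only [← ofReal_norm]
          rw [← ENNReal.ofReal_add (norm_nonneg _) (norm_nonneg _)]
          refine ENNReal.ofReal_le_ofReal ?_
          linarith [norm_sub_norm_le (testElt (f n) (hf n)) U]
      _ ≤ ‖U‖ₑ + ‖U‖ₑ := by gcongr; exact (hfU n).trans (min_le_left _ _)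
      _ = _ := by ring
  have hbd : ∀ n, ∫⁻ x, ‖f n x‖ₑ ^ r ≤ ((C * (d * 2) ^ r : NNReal) : ENNReal) * ‖U‖ₑ ^ r := by
    intro n
    have hd1 : (1 : ENNReal) ≤ d := by exact_mod_cast hd
    have hk : ((d * (2 * ‖U‖₊) : NNReal) : ENNReal) = d * (2 * ‖U‖ₑ) := by
      push_cast; rfl
    refine (hC (f n) (hf n) (d * (2 * ‖U‖₊)) ?_ ?_).trans_eq ?_
    · rw [hk, eLpNorm_congr_ae (fn_testElt (hf n)).symm]
      calc _ ≤ _ := (H1.eLpNorm_fn_le _).trans (hnorm n)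
        _ = 1 * (2 * ‖U‖ₑ) := (one_mul _).symm
        _ ≤ _ := by gcongr
    · rw [hk]
      refine (hf n).eLpNorm_fderiv_le fun k => ?_
      rw [eLpNorm_congr_ae (partialFn_testElt (hf n) k).symm]
      exact (H1.eLpNorm_partialFn_le _ k).trans (hnorm n)
    · rw [enorm_eq_nnnorm, ← ENNReal.coe_rpow_of_nonneg _ hr0.le,
        ← ENNReal.coe_rpow_of_nonneg _ hr0.le, ← ENNReal.coe_mul, ← ENNReal.coe_mul,
        ← mul_assoc (d : NNReal), NNReal.mul_rpow, mul_assoc]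
  have hconv : Filter.Tendsto (fun n => eLpNorm (f n - H1.fn U) 2 volume) Filter.atTop
      (nhds 0) := by
    have hz : Filter.Tendsto (fun n : ℕ => ((n : ENNReal) + 1)⁻¹) Filter.atTop (nhds 0) := by
      have := (ENNReal.tendsto_inv_nat_nhds_zero).comp (Filter.tendsto_add_atTop_nat 1)
      simpa [Function.comp_def] using this
    refine tendsto_of_tendsto_of_tendsto_of_le_of_le tendsto_const_nhds hz
      (fun _ => zero_le) fun n => ?_
    have : f n - H1.fn U =ᵐ[volume] H1.fn (testElt (f n) (hf n) - U) := by
      filter_upwards [H1.fn_sub (testElt (f n) (hf n)) U, fn_testElt (hf n)] with x h1 h2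
      rw [h1, h2, Pi.sub_apply]
    dsimp only
    rw [eLpNorm_congr_ae this]
    exact ((H1.eLpNorm_fn_le _).trans (hfU n)).trans (min_le_right _ _)
  -- Convergence in `L²` gives an almost everywhere convergent subsequence, to which Fatou's lemma
  -- applies.
  obtain ⟨ns, -, hae⟩ := (tendstoInMeasure_of_tendsto_eLpNorm two_ne_zero
    (fun n => (hf n).memLp.1) (H1.memLp_fn U).1 hconv).exists_seq_tendsto_ae
  calc ∫⁻ x, ‖H1.fn U x‖ₑ ^ r
      = ∫⁻ x, Filter.liminf (fun i => ‖f (ns i) x‖ₑ ^ r) Filter.atTop := by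
        refine lintegral_congr_ae ?_
        filter_upwards [hae] with x hx
        exact ((ENNReal.continuous_rpow_const.tendsto _).comp hx.enorm).liminf_eq.symm
    _ ≤ Filter.liminf (fun i => ∫⁻ x, ‖f (ns i) x‖ₑ ^ r) Filter.atTop :=
        lintegral_liminf_le' fun i => ((hf (ns i)).memLp.1.enorm.pow_const _)
    _ ≤ Filter.liminf (fun _ : ℕ => ((C * (d * 2) ^ r : NNReal) : ENNReal) * ‖U‖ₑ ^ r)
          Filter.atTop := Filter.liminf_le_liminf (Filter.Eventually.of_forall fun i => hbd _)
    _ = _ := Filter.liminf_const _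

end

/-! ### Homogeneity of `g` and differentiability of `u ↦ ∫ g(u)` on `H¹`. -/

noncomputable section

variable {d N : ℕ}

namespace Admissible

variable {p : ℝ} {g : Cn N → ℝ} (hg : Admissible d p g)
include hg

lemma differentiable : Differentiable ℝ g := hg.contDiff.differentiable (by norm_num)

lemma contDiff_fderiv : ContDiff ℝ 1 (fderiv ℝ g) := hg.contDiff.fderiv_right (by norm_num)

lemma fderiv_smul {r : ℝ} (hr : 0 < r) (z : Cn N) :
    fderiv ℝ g (r • z) = r ^ (p - 1) • fderiv ℝ g z := by
  have h1 : (fun z => g (r • z)) = fun z => r ^ p * g z :=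
    funext fun z => hg.homogeneous r z hr.le
  have h2 : r • fderiv ℝ g (r • z) = r ^ p • fderiv ℝ g z := by
    have := congrArg (fun F => fderiv ℝ F z) h1
    simp only [fderiv_comp_smul] at this
    rw [this, fderiv_const_mul (hg.differentiable z)]
  rw [Real.rpow_sub_one hr.ne', div_eq_inv_mul, mul_smul, ← h2, smul_smul,
    inv_mul_cancel₀ hr.ne', one_smul]

lemma map_zero : g 0 = 0 := by
  have := hg.homogeneous 0 0 le_rfl
  rwa [Real.zero_rpow (by linarith [hg.two_lt]), zero_mul, smul_zero] at this

lemma fderiv_zero : fderiv ℝ g 0 = 0 := by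
  have h := hg.fderiv_smul (r := 2) two_pos 0
  rw [smul_zero] at h
  have h1 : (1 : ℝ) < 2 ^ (p - 1) := Real.one_lt_rpow one_lt_two (by linarith [hg.two_lt])
  have h2 : ((2 : ℝ) ^ (p - 1) - 1) • fderiv ℝ g 0 = 0 := by
    rw [sub_smul, one_smul, ← h, sub_self]
  exact (smul_eq_zero.1 h2).resolve_left (by linarith)

/-- Euler's identity. -/
lemma fderiv_self (z : Cn N) : fderiv ℝ g z z = p * g z := by
  have h1 : HasDerivAt (fun r : ℝ => g (r • z)) (fderiv ℝ g z z) 1 := by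
    have hs : HasDerivAt (fun r : ℝ => r • z) z 1 := by
      simpa using (hasDerivAt_id (1 : ℝ)).smul_const z
    have hd : HasFDerivAt g (fderiv ℝ g z) ((1 : ℝ) • z) := by
      rw [one_smul]; exact (hg.differentiable z).hasFDerivAt
    exact hd.comp_hasDerivAt (1 : ℝ) hs
  have h2 : HasDerivAt (fun r : ℝ => r ^ p * g z) (p * g z) 1 := by
    have := (Real.hasDerivAt_rpow_const (x := 1) (p := p) (Or.inl one_ne_zero)).mul_const (g z)
    simpa using this
  refine h1.unique (h2.congr_of_eventuallyEq ?_)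
  filter_upwards [lt_mem_nhds (zero_lt_one' ℝ)] with r hr
  exact hg.homogeneous r z hr.le

/-- Since `g` is `C²`, `fderiv ℝ g` is Lipschitz on the compact unit ball, which gives both bounds
there. Homogeneity carries them to all arguments, with scaling factors `‖z‖` and `‖z‖ + ‖h‖`
respectively. -/
lemma exists_taylor_bound : ∃ C : ℝ, 0 ≤ C ∧
    (∀ z, ‖fderiv ℝ g z‖ ≤ C * ‖z‖ ^ (p - 1)) ∧
    ∀ z h, |g (z + h) - g z - fderiv ℝ g z h| ≤ C * ((‖z‖ + ‖h‖) ^ (p - 2) * ‖h‖ ^ 2) := by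
  have hp := hg.two_lt
  obtain ⟨K, hK⟩ := hg.contDiff_fderiv.contDiffOn.exists_lipschitzOnWith one_ne_zero
    (convex_closedBall (0 : Cn N) 1) (isCompact_closedBall _ _)
  refine ⟨K, K.2, fun z => ?_, fun z h => ?_⟩
  · rcases eq_or_ne z 0 with rfl | hz
    · rw [hg.fderiv_zero, norm_zero]; positivity
    have hzpos : 0 < ‖z‖ := norm_pos_iff.2 hz
    have hu : ‖‖z‖⁻¹ • z‖ = 1 := by
      rw [norm_smul, norm_inv, norm_norm, inv_mul_cancel₀ hzpos.ne']
    have hz' : z = ‖z‖ • (‖z‖⁻¹ • z) := by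
      rw [smul_smul, mul_inv_cancel₀ hzpos.ne', one_smul]
    have := hK.norm_sub_le (x := ‖z‖⁻¹ • z) (y := 0) (by simp [hu]) (by simp)
    rw [hg.fderiv_zero, sub_zero, sub_zero, hu, mul_one] at this
    calc ‖fderiv ℝ g z‖ = ‖z‖ ^ (p - 1) * ‖fderiv ℝ g (‖z‖⁻¹ • z)‖ := by
          conv_lhs => rw [hz', hg.fderiv_smul hzpos]
          rw [norm_smul, Real.norm_of_nonneg (by positivity)]
      _ ≤ ‖z‖ ^ (p - 1) * K := by gcongr
      _ = _ := mul_comm _ _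
  · have unit : ∀ z h : Cn N, ‖z‖ + ‖h‖ ≤ 1 →
        |g (z + h) - g z - fderiv ℝ g z h| ≤ K * ‖h‖ ^ 2 := by
      intro z h hzh
      have hzb : z ∈ Metric.closedBall (0 : Cn N) 1 := by
        simpa using le_trans (by linarith [norm_nonneg h]) hzh
      -- Mean value inequality for `g` minus its linear part at `z`, on a convex set where the
      -- derivative is at most `K ‖h‖`.
      have := Convex.norm_image_sub_le_of_norm_hasFDerivWithin_le (𝕜 := ℝ)
        (f := fun y => g y - fderiv ℝ g z y) (f' := fun y => fderiv ℝ g y - fderiv ℝ g z)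
        (C := K * ‖h‖) (s := Metric.closedBall (0 : Cn N) 1 ∩ Metric.closedBall z ‖h‖)
        (x := z) (y := z + h)
        (fun y _ => ((hg.differentiable y).hasFDerivAt.sub
          (fderiv ℝ g z).hasFDerivAt).hasFDerivWithinAt)
        (fun y hy => (hK.norm_sub_le hy.1 hzb).trans (by
          gcongr; simpa [dist_eq_norm] using hy.2))
        ((convex_closedBall _ _).inter (convex_closedBall _ _))
        ⟨hzb, by simp⟩ ⟨by simpa using (norm_add_le z h).trans hzh, by simp⟩
      rw [Real.norm_eq_abs, _root_.map_add, add_sub_cancel_left, mul_assoc, ← sq] at this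
      refine le_trans (le_of_eq (congrArg _ ?_)) this
      ring
    set R := ‖z‖ + ‖h‖ with hR
    have hR0 : 0 ≤ R := by positivity
    rcases hR0.eq_or_lt with h0 | hRpos
    · have hh : h = 0 := norm_le_zero_iff.1 (by linarith [norm_nonneg z, norm_nonneg h])
      simp [hh]
    have hs : ∀ v : Cn N, R • (R⁻¹ • v) = v := fun v => by
      rw [smul_smul, mul_inv_cancel₀ hRpos.ne', one_smul]
    have hnorm : ∀ v : Cn N, ‖R⁻¹ • v‖ = R⁻¹ * ‖v‖ := fun v => by
      rw [norm_smul, Real.norm_of_nonneg (by positivity)]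
    have key := unit (R⁻¹ • z) (R⁻¹ • h) (by
      rw [hnorm, hnorm, ← mul_add, ← hR, inv_mul_cancel₀ hRpos.ne'])
    have e1 : g (z + h) = R ^ p * g (R⁻¹ • z + R⁻¹ • h) := by
      rw [← hg.homogeneous _ _ hR0, smul_add, hs, hs]
    have e2 : g z = R ^ p * g (R⁻¹ • z) := by rw [← hg.homogeneous _ _ hR0, hs]
    have e3 : fderiv ℝ g z h = R ^ p * fderiv ℝ g (R⁻¹ • z) (R⁻¹ • h) := by
      conv_lhs => rw [← hs z, hg.fderiv_smul hRpos, ← hs h]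
      rw [_root_.smul_apply, _root_.map_smul, smul_eq_mul, smul_eq_mul, ← mul_assoc,
        ← Real.rpow_add_one hRpos.ne', sub_add_cancel]
    rw [e1, e2, e3, ← mul_sub, ← mul_sub, abs_mul, abs_of_nonneg (by positivity)]
    calc R ^ p * |_| ≤ R ^ p * (K * ‖R⁻¹ • h‖ ^ 2) := by gcongr
      _ = K * (R ^ (p - 2) * ‖h‖ ^ 2) := by
        rw [hnorm, Real.rpow_sub hRpos, Real.rpow_two]
        field_simp

end Admissible

lemma rpow_sub_one_mul_le {p a b : ℝ} (hp : 2 < p) (ha : 0 ≤ a) (hb : 0 ≤ b) :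
    a ^ (p - 1) * b ≤ a ^ p + b ^ p := by
  have key : ∀ c : ℝ, 0 ≤ c → c ^ (p - 1) * c = c ^ p := fun c hc => by
    rw [← Real.rpow_add_one' hc (by linarith), sub_add_cancel]
  rcases le_total a b with h | h
  · calc a ^ (p - 1) * b ≤ b ^ (p - 1) * b := by gcongr; linarith
      _ = b ^ p := key b hb
      _ ≤ _ := le_add_of_nonneg_left (by positivity)
  · calc a ^ (p - 1) * b ≤ a ^ (p - 1) * a := by gcongr
      _ = a ^ p := key a ha
      _ ≤ _ := le_add_of_nonneg_right (by positivity)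

lemma add_rpow_le_two_rpow_mul {p a b : ℝ} (hp : 0 ≤ p) (ha : 0 ≤ a) (hb : 0 ≤ b) :
    (a + b) ^ p ≤ 2 ^ p * (a ^ p + b ^ p) := by
  wlog h : a ≤ b generalizing a b
  · rw [add_comm a, add_comm (a ^ p)]; exact this hb ha (le_of_not_ge h)
  calc (a + b) ^ p ≤ (2 * b) ^ p := by gcongr; linarith
    _ = 2 ^ p * b ^ p := Real.mul_rpow zero_le_two hb
    _ ≤ _ := by gcongr; exact le_add_of_nonneg_left (by positivity)

section potential

variable {p : ℝ} {g : Cn N → ℝ}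

lemma Admissible.exists_norm_rpow_bound (hd : 1 ≤ d) (hg : Admissible d p g) :
    ∃ C : ℝ, 0 ≤ C ∧ ∀ U : H1 d N, Integrable (fun x => ‖H1.fn U x‖ ^ p) volume ∧
      ∫ x, ‖H1.fn U x‖ ^ p ≤ C * ‖U‖ ^ p := by
  have hp := hg.two_lt
  obtain ⟨C, hC⟩ := exists_lintegral_rpow_le (d := d) N hd hp.le fun h => (hg.subcritical h).le
  refine ⟨C, C.2, fun U => ?_⟩
  have hp0 : 0 ≤ p := by linarith
  have e : ∀ x, ‖‖H1.fn U x‖ ^ p‖ₑ = ‖H1.fn U x‖ₑ ^ p := fun x => by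
    rw [Real.enorm_rpow_of_nonneg (norm_nonneg _) hp0, enorm_norm]
  have hb : ∫⁻ x, ‖‖H1.fn U x‖ ^ p‖ₑ ≤ ENNReal.ofReal (C * ‖U‖ ^ p) := by
    simp only [e]
    refine (hC U).trans_eq ?_
    rw [ENNReal.ofReal_mul C.coe_nonneg, ← ENNReal.ofReal_rpow_of_nonneg (norm_nonneg _) hp0, ofReal_norm]
    simp
  have hm : AEStronglyMeasurable (fun x => ‖H1.fn U x‖ ^ p) volume :=
    ((H1.memLp_fn U).1.norm.aemeasurable.pow_const p).aestronglyMeasurable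
  refine ⟨⟨hm, hb.trans_lt ENNReal.ofReal_lt_top⟩, ?_⟩
  rw [integral_eq_lintegral_of_nonneg_ae (Filter.Eventually.of_forall fun x => by positivity) hm]
  refine ENNReal.toReal_le_of_le_ofReal (by positivity) ?_
  refine le_trans (le_of_eq (lintegral_congr fun x => ?_)) hb
  rw [Real.enorm_of_nonneg (by positivity)]

variable (hg : Admissible d p g)
include hg

lemma Admissible.aestronglyMeasurable_fderiv (U V : H1 d N) :
    AEStronglyMeasurable (fun x => fderiv ℝ g (H1.fn U x) (H1.fn V x)) volume :=
  have hc : Continuous fun q : Cn N × Cn N => fderiv ℝ g q.1 q.2 :=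
    (hg.contDiff_fderiv.continuous.comp continuous_fst).clm_apply continuous_snd
  hc.comp_aestronglyMeasurable ((H1.memLp_fn U).1.prodMk (H1.memLp_fn V).1)

lemma Admissible.exists_norm_fderiv_apply_le : ∃ C : ℝ, 0 ≤ C ∧ ∀ z h : Cn N,
    ‖fderiv ℝ g z h‖ ≤ C * (‖z‖ ^ p + ‖h‖ ^ p) := by
  obtain ⟨C, hC0, hC, -⟩ := hg.exists_taylor_bound
  refine ⟨C, hC0, fun z h => ((fderiv ℝ g z).le_opNorm h).trans ?_⟩
  calc ‖fderiv ℝ g z‖ * ‖h‖ ≤ C * ‖z‖ ^ (p - 1) * ‖h‖ := by gcongr; exact hC z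
    _ = C * (‖z‖ ^ (p - 1) * ‖h‖) := mul_assoc _ _ _
    _ ≤ _ := by
      gcongr; exact rpow_sub_one_mul_le hg.two_lt (norm_nonneg _) (norm_nonneg _)

variable (hd : 1 ≤ d)
include hd

lemma Admissible.integrable_norm_rpow (U : H1 d N) :
    Integrable (fun x => ‖H1.fn U x‖ ^ p) volume := by
  obtain ⟨C, -, h⟩ := hg.exists_norm_rpow_bound hd
  exact (h U).1

lemma Admissible.integrable_fderiv (U V : H1 d N) :
    Integrable (fun x => fderiv ℝ g (H1.fn U x) (H1.fn V x)) volume := by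
  obtain ⟨C, -, hC⟩ := hg.exists_norm_fderiv_apply_le
  exact (((hg.integrable_norm_rpow hd U).add (hg.integrable_norm_rpow hd V)).const_mul C).mono'
    (hg.aestronglyMeasurable_fderiv U V) (Filter.Eventually.of_forall fun x => hC _ _)

/-- Euler's identity writes `g(u)` as `p⁻¹` times the derivative at `u` in direction `u`. -/
lemma Admissible.integrable_potential (U : H1 d N) :
    Integrable (fun x => g (H1.fn U x)) volume := by
  have hp0 : p ≠ 0 := by linarith [hg.two_lt]
  have := (hg.integrable_fderiv hd U U).const_mul p⁻¹
  simpa only [hg.fderiv_self, inv_mul_cancel_left₀ hp0] using this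

/-- The derivative of `U ↦ ∫ g(U)`. -/
theorem Admissible.exists_potentialDeriv (U : H1 d N) :
    ∃ B : H1 d N →L[ℝ] ℝ, (∀ V, B V = ∫ x, fderiv ℝ g (H1.fn U x) (H1.fn V x)) ∧
      HasFDerivAt (fun V : H1 d N => ∫ x, g (H1.fn V x)) B U := by
  have hp := hg.two_lt
  obtain ⟨S, hS0, hS⟩ := hg.exists_norm_rpow_bound hd
  obtain ⟨D, hD0, hD⟩ := hg.exists_norm_fderiv_apply_le
  obtain ⟨T, hT0, -, hT⟩ := hg.exists_taylor_bound
  let B₀ : H1 d N →ₗ[ℝ] ℝ :=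
    { toFun := fun V => ∫ x, fderiv ℝ g (H1.fn U x) (H1.fn V x)
      map_add' := fun V W => by
        rw [← integral_add (hg.integrable_fderiv hd U V) (hg.integrable_fderiv hd U W)]
        refine integral_congr_ae ?_
        filter_upwards [H1.fn_add V W] with x hx
        rw [hx, map_add]
      map_smul' := fun c V => by
        rw [RingHom.id_apply, smul_eq_mul, ← integral_const_mul]
        refine integral_congr_ae ?_
        filter_upwards [H1.fn_smul c V] with x hx
        rw [hx, map_smul, smul_eq_mul] }
  -- The pointwise bound by `|u|^p + |v|^p` is not homogeneous in `V`, so it is used on unit vectors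
  -- and extended by linearity.
  have hunit : ∀ V : H1 d N, ‖V‖ = 1 → ‖B₀ V‖ ≤ D * (S * ‖U‖ ^ p + S) := by
    intro V hV
    have hi := (hg.integrable_norm_rpow hd U).add (hg.integrable_norm_rpow hd V)
    calc ‖B₀ V‖ ≤ ∫ x, D * (‖H1.fn U x‖ ^ p + ‖H1.fn V x‖ ^ p) :=
          norm_integral_le_of_norm_le (hi.const_mul D)
            (Filter.Eventually.of_forall fun x => hD _ _)
      _ = D * ((∫ x, ‖H1.fn U x‖ ^ p) + ∫ x, ‖H1.fn V x‖ ^ p) := by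
          rw [integral_const_mul, integral_add (hg.integrable_norm_rpow hd U)
            (hg.integrable_norm_rpow hd V)]
      _ ≤ D * (S * ‖U‖ ^ p + S) := by
          gcongr
          · exact (hS U).2
          · simpa [hV] using (hS V).2
  have hscale : ∀ V : H1 d N, V ≠ 0 → ‖‖V‖⁻¹ • V‖ = 1 ∧ ‖V‖ • (‖V‖⁻¹ • V) = V := by
    intro V hV
    have : ‖V‖ ≠ 0 := norm_ne_zero_iff.2 hV
    exact ⟨by rw [norm_smul, norm_inv, norm_norm, inv_mul_cancel₀ this],
      by rw [smul_smul, mul_inv_cancel₀ this, one_smul]⟩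
  let B : H1 d N →L[ℝ] ℝ := B₀.mkContinuous (D * (S * ‖U‖ ^ p + S)) fun V => by
    rcases eq_or_ne V 0 with rfl | hV
    · simp
    obtain ⟨h1, h2⟩ := hscale V hV
    conv_lhs => rw [← h2]
    rw [map_smul, norm_smul, norm_norm, mul_comm]
    gcongr
    exact hunit _ h1
  refine ⟨B, fun V => rfl, ?_⟩
  set M := T * (2 ^ p * (S * ‖U‖ ^ p + S)) with hM
  -- Writing `V = ‖V‖ k` with `k` of norm one pulls `‖V‖²` out of the Taylor remainder. As `‖V‖ ≤
  -- 1`, what remains is controlled by `|u|^p + |k|^p`, whose integral is bounded independently of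
  -- `V`.
  have hbound : ∀ V : H1 d N, ‖V‖ ≤ 1 →
      ‖(∫ x, g (H1.fn (U + V) x)) - (∫ x, g (H1.fn U x)) - B V‖ ≤ M * ‖V‖ ^ 2 := by
    intro V hV1
    rcases eq_or_ne V 0 with rfl | hV
    · simp
    obtain ⟨h1, h2⟩ := hscale V hV
    set k := ‖V‖⁻¹ • V with hk
    have e : (∫ x, g (H1.fn (U + V) x)) - (∫ x, g (H1.fn U x)) - B V =
        ∫ x, (g (H1.fn (U + V) x) - g (H1.fn U x) - fderiv ℝ g (H1.fn U x) (H1.fn V x)) := by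
      have hsub : Integrable (fun x => g (H1.fn (U + V) x) - g (H1.fn U x)) volume :=
        (hg.integrable_potential hd _).sub (hg.integrable_potential hd _)
      rw [integral_sub hsub
        (hg.integrable_fderiv hd U V), integral_sub (hg.integrable_potential hd _)
        (hg.integrable_potential hd _)]
      rfl
    have hi := (hg.integrable_norm_rpow hd U).add (hg.integrable_norm_rpow hd k)
    rw [e]
    calc ‖∫ x, (g (H1.fn (U + V) x) - g (H1.fn U x) - fderiv ℝ g (H1.fn U x) (H1.fn V x))‖
        ≤ ∫ x, T * ‖V‖ ^ 2 * 2 ^ p * (‖H1.fn U x‖ ^ p + ‖H1.fn k x‖ ^ p) := by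
          refine norm_integral_le_of_norm_le (hi.const_mul _) ?_
          filter_upwards [H1.fn_add U V, H1.fn_smul ‖V‖⁻¹ V] with x hx1 hx2
          have hVn : ‖H1.fn V x‖ = ‖V‖ * ‖H1.fn k x‖ := by
            rw [hx2, norm_smul, norm_inv, norm_norm, mul_inv_cancel_left₀]
            exact norm_ne_zero_iff.2 hV
          rw [hx1, Real.norm_eq_abs]
          set a := ‖H1.fn U x‖ with ha
          set b := ‖H1.fn k x‖ with hb
          have ha0 : 0 ≤ a := norm_nonneg _
          have hb0 : 0 ≤ b := norm_nonneg _
          refine (hT _ _).trans ?_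
          rw [hVn]
          calc T * ((a + ‖V‖ * b) ^ (p - 2) * (‖V‖ * b) ^ 2)
              ≤ T * ((a + b) ^ (p - 2) * (‖V‖ ^ 2 * (a + b) ^ 2)) := by
                have : ‖V‖ * b ≤ b := mul_le_of_le_one_left hb0 hV1
                rw [mul_pow]
                gcongr; linarith
            _ = T * ‖V‖ ^ 2 * (a + b) ^ p := by
                have : (a + b) ^ p = (a + b) ^ (p - 2) * (a + b) ^ 2 := by
                  rw [← Real.rpow_two, ← Real.rpow_add_of_nonneg (by positivity) (by linarith)
                    zero_le_two, sub_add_cancel]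
                rw [this]; ring
            _ ≤ T * ‖V‖ ^ 2 * (2 ^ p * (a ^ p + b ^ p)) := by
                gcongr; exact add_rpow_le_two_rpow_mul (by linarith) ha0 hb0
            _ = _ := by ring
      _ = T * ‖V‖ ^ 2 * 2 ^ p * ((∫ x, ‖H1.fn U x‖ ^ p) + ∫ x, ‖H1.fn k x‖ ^ p) := by
          rw [integral_const_mul, integral_add (hg.integrable_norm_rpow hd U)
            (hg.integrable_norm_rpow hd k)]
      _ ≤ T * ‖V‖ ^ 2 * 2 ^ p * (S * ‖U‖ ^ p + S) := by
          gcongr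
          · exact (hS U).2
          · simpa [h1] using (hS k).2
      _ = M * ‖V‖ ^ 2 := by rw [hM]; ring
  rw [hasFDerivAt_iff_isLittleO_nhds_zero]
  have hO : (fun V : H1 d N => (∫ x, g (H1.fn (U + V) x)) - (∫ x, g (H1.fn U x)) - B V)
      =O[nhds 0] fun V => ‖V‖ ^ 2 := by
    refine Asymptotics.IsBigO.of_bound M ?_
    filter_upwards [Metric.closedBall_mem_nhds (0 : H1 d N) one_pos] with V hV
    rw [norm_pow, norm_norm]
    exact hbound V (by simpa using hV)
  exact hO.trans_isLittleO (by
    simpa using (Asymptotics.isLittleO_norm_pow_id (E' := H1 d N) one_lt_two))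

end potential

end

/-! ### The derivative of the action, and critical points as weak solutions. -/

noncomputable section

variable {d N : ℕ}

/-- The underlying function in `L²`, as a continuous linear map. -/
def H1.fnL (d N : ℕ) : H1 d N →L[ℝ] L2 d N :=
  (ContinuousLinearMap.fst ℝ (L2 d N) (Fin d → L2 d N)).comp (H1 d N).subtypeL

/-- The `k`-th weak partial derivative in `L²`, as a continuous linear map. -/
def H1.partialL (d N : ℕ) (k : Fin d) : H1 d N →L[ℝ] L2 d N :=
  ((ContinuousLinearMap.proj k).comp
    (ContinuousLinearMap.snd ℝ (L2 d N) (Fin d → L2 d N))).comp (H1 d N).subtypeL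

/-- The first variation of the action at `U` in direction `V`. -/
def firstVar (p : ℝ) (g : Cn N → ℝ) (ω : ℝ) (U V : H1 d N) : ℝ :=
  ((∑ k, ∫ x, inner ℝ (H1.partialFn U k x) (H1.partialFn V k x)) +
    1 / p * ∫ x, fderiv ℝ g (H1.fn U x) (H1.fn V x)) +
    ω * ∫ x, inner ℝ (H1.fn U x) (H1.fn V x)

lemma integral_half_norm_sq (u : L2 d N) : ∫ x, 1 / 2 * ‖u x‖ ^ 2 = 1 / 2 * ‖u‖ ^ 2 := by
  rw [← real_inner_self_eq_norm_sq, L2.inner_def, integral_const_mul]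
  simp only [real_inner_self_eq_norm_sq]

lemma hasFDerivAt_half_norm_sq (u : L2 d N) :
    HasFDerivAt (fun v : L2 d N => 1 / 2 * ‖v‖ ^ 2) (innerSL ℝ u) u := by
  have := (hasStrictFDerivAt_norm_sq u).hasFDerivAt.const_mul (1 / 2)
  refine this.congr_fderiv ?_
  ext v
  simp

variable {p : ℝ} {g : Cn N → ℝ} {ω : ℝ}

theorem exists_hasFDerivAt_action (hg : Admissible d p g) (hd : 1 ≤ d) (ω : ℝ) (U : H1 d N) :
    ∃ D : H1 d N →L[ℝ] ℝ, (∀ V, D V = firstVar p g ω U V) ∧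
      HasFDerivAt (action p g ω) D U := by
  obtain ⟨B, hB, hBd⟩ := hg.exists_potentialDeriv hd U
  refine ⟨((∑ k, (innerSL ℝ (U.1.2 k)).comp (H1.partialL d N k)) + (1 / p) • B) +
    ω • (innerSL ℝ U.1.1).comp (H1.fnL d N), fun V => ?_, ?_⟩
  · simp only [_root_.add_apply, _root_.smul_apply, _root_.sum_apply,
      ContinuousLinearMap.comp_apply, innerSL_apply_apply, L2.inner_def, smul_eq_mul, hB]
    rfl
  · have e : action p g ω = fun V : H1 d N =>
        ((∑ k, 1 / 2 * ‖H1.partialL d N k V‖ ^ 2) + 1 / p * ∫ x, g (H1.fn V x)) +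
          ω * (1 / 2 * ‖H1.fnL d N V‖ ^ 2) := by
      funext V
      rw [action, energy, mass, integral_const_mul (1 / p)]
      have e1 : ∀ k, ∫ x, 1 / 2 * ‖H1.partialFn V k x‖ ^ 2 =
          1 / 2 * ‖H1.partialL d N k V‖ ^ 2 := fun k => integral_half_norm_sq (V.1.2 k)
      have e2 : ∫ x, 1 / 2 * ‖H1.fn V x‖ ^ 2 = 1 / 2 * ‖H1.fnL d N V‖ ^ 2 :=
        integral_half_norm_sq V.1.1
      simp only [e1, e2]
    rw [e]
    refine (HasFDerivAt.add (HasFDerivAt.fun_sum fun k _ => ?_) (hBd.const_mul _)).add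
      (HasFDerivAt.const_mul ?_ _)
    · exact (hasFDerivAt_half_norm_sq (H1.partialL d N k U)).comp U
        (H1.partialL d N k).hasFDerivAt
    · exact (hasFDerivAt_half_norm_sq (H1.fnL d N U)).comp U (H1.fnL d N).hasFDerivAt

theorem mem_solSet_iff (hg : Admissible d p g) (hd : 1 ≤ d) {U : H1 d N} :
    U ∈ solSet d p g ω ↔ U ≠ 0 ∧ ∀ V, firstVar p g ω U V = 0 := by
  obtain ⟨D, hD, hDd⟩ := exists_hasFDerivAt_action hg hd ω U
  refine and_congr_right fun _ => ⟨fun h V => ?_, fun h => ?_⟩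
  · rw [← hD, hDd.unique h, _root_.zero_apply]
  · have : D = 0 := by ext V; rw [hD, h, _root_.zero_apply]
    exact this ▸ hDd

lemma testElt_add {f f' : Sp d → Cn N} (hf : IsTestVec f) (hf' : IsTestVec f')
    (h : IsTestVec (f + f')) : testElt (f + f') h = testElt f hf + testElt f' hf' := by
  refine H1.ext_fn ?_
  filter_upwards [fn_testElt h, fn_testElt hf, fn_testElt hf',
    H1.fn_add (testElt f hf) (testElt f' hf')] with x h1 h2 h3 h4
  rw [h1, h4, h2, h3, Pi.add_apply]

lemma IsTestVec.add {f f' : Sp d → Cn N} (hf : IsTestVec f) (hf' : IsTestVec f') :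
    IsTestVec (f + f') := ⟨hf.1.add hf'.1, hf.2.add hf'.2⟩

lemma IsTestVec.comp_clm {f : Sp d → Cn N} (hf : IsTestVec f) (L : Cn N →L[ℝ] ℝ) :
    IsTest fun x => L (f x) :=
  ⟨L.contDiff.comp hf.1, hf.2.comp_left (map_zero L)⟩

lemma inner_single_one (z : Cn N) (j : Fin N) :
    inner ℝ z (EuclideanSpace.single j (1 : ℂ)) = (z j).re := by
  simp [PiLp.inner_apply, Complex.inner, apply_ite Complex.re]

lemma inner_single_I (z : Cn N) (j : Fin N) :
    inner ℝ z (EuclideanSpace.single j Complex.I) = (z j).im := by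
  simp only [PiLp.inner_apply, Complex.inner, PiLp.single_apply, ite_mul, zero_mul,
    apply_ite Complex.re]
  simp

lemma eq_sum_re_im_smul_single (z : Cn N) : z = ∑ j,
    ((z j).re • EuclideanSpace.single j (1 : ℂ) + (z j).im • EuclideanSpace.single j Complex.I) := by
  ext i
  rw [WithLp.ofLp_sum, Finset.sum_apply, Finset.sum_eq_single i]
  · simp [Complex.re_add_im]
  · intro j _ hj
    simp [hj.symm]
  · simp

/-- A continuous linear functional vanishing on all `φ e_j` and `φ i e_j` vanishes on `H¹`. -/
lemma clm_eq_zero_of_testElt (D : H1 d N →L[ℝ] ℝ)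
    (h : ∀ (φ : Sp d → ℝ) (hφ : IsTest φ) (j : Fin N),
      D (testElt _ (hφ.smul_const (EuclideanSpace.single j 1))) = 0 ∧
      D (testElt _ (hφ.smul_const (EuclideanSpace.single j Complex.I))) = 0) :
    D = 0 := by
  have htest : ∀ (f : Sp d → Cn N) (hf : IsTestVec f), D (testElt f hf) = 0 := by
    intro f hf
    have hL : ∀ c : Cn N, IsTest fun x => inner ℝ (f x) c := fun c => by
      simpa only [innerSL_apply_apply, real_inner_comm] using hf.comp_clm (innerSL ℝ c)
    have hsum : f = ∑ j, ((fun x => inner ℝ (f x) (EuclideanSpace.single j (1 : ℂ)) •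
        EuclideanSpace.single j (1 : ℂ)) + fun x =>
        inner ℝ (f x) (EuclideanSpace.single j Complex.I) •
          EuclideanSpace.single j Complex.I) := by
      funext x
      rw [Finset.sum_apply]
      simp only [Pi.add_apply, inner_single_one, inner_single_I]
      exact eq_sum_re_im_smul_single (f x)
    -- `testElt` takes a proof as an argument, so the predicate bundles one in order to allow
    -- induction over the sum.
    let P : (Sp d → Cn N) → Prop := fun f => ∃ h : IsTestVec f, D (testElt f h) = 0
    have hadd : ∀ a b, P a → P b → P (a + b) := by
      rintro a b ⟨ha, ha'⟩ ⟨hb, hb'⟩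
      exact ⟨ha.add hb, by rw [testElt_add ha hb, map_add, ha', hb', add_zero]⟩
    have hzero : P 0 := by
      have h0 : IsTestVec (0 : Sp d → Cn N) := ⟨contDiff_const, HasCompactSupport.zero⟩
      have : testElt 0 h0 = 0 := H1.ext_fn ((fn_testElt h0).trans H1.fn_zero.symm)
      exact ⟨h0, by rw [this, map_zero]⟩
    have key : P f := by
      rw [hsum]
      exact Finset.sum_induction _ P hadd hzero fun j _ =>
        hadd _ _ ⟨_, (h _ (hL _) j).1⟩ ⟨_, (h _ (hL _) j).2⟩
    exact key.2
  ext U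
  rw [_root_.zero_apply]
  have hcl : U ∈ closure {V : H1 d N | D V = 0} := by
    rw [Metric.mem_closure_iff]
    intro ε hε
    obtain ⟨f, hf, hfU⟩ := exists_testElt_sub_enorm_le U
      (ENNReal.ofReal_pos.2 (half_pos hε))
    refine ⟨testElt f hf, htest f hf, ?_⟩
    rw [dist_comm, dist_eq_norm]
    rw [← ofReal_norm, ENNReal.ofReal_le_ofReal_iff (half_pos hε).le] at hfU
    linarith
  rwa [(isClosed_eq D.continuous continuous_const).closure_eq] at hcl

lemma firstVar_testElt_smul_const {φ : Sp d → ℝ} (hφ : IsTest φ) (c : Cn N) (U : H1 d N) :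
    firstVar p g ω U (testElt _ (hφ.smul_const c)) =
      ((∑ k, ∫ x, pderiv k φ x * inner ℝ (H1.partialFn U k x) c) +
        1 / p * ∫ x, φ x * fderiv ℝ g (H1.fn U x) c) +
        ω * ∫ x, φ x * inner ℝ (H1.fn U x) c := by
  have h0 := fn_testElt (hφ.smul_const c)
  have e1 : ∀ k, ∫ x, inner ℝ (H1.partialFn U k x)
      (H1.partialFn (testElt _ (hφ.smul_const c)) k x) =
        ∫ x, pderiv k φ x * inner ℝ (H1.partialFn U k x) c := fun k => by
    refine integral_congr_ae ?_
    filter_upwards [partialFn_testElt (hφ.smul_const c) k] with x hx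
    rw [hx, vpderiv_smul_const hφ, real_inner_smul_right]
  have e2 : ∫ x, fderiv ℝ g (H1.fn U x) (H1.fn (testElt _ (hφ.smul_const c)) x) =
      ∫ x, φ x * fderiv ℝ g (H1.fn U x) c := by
    refine integral_congr_ae ?_
    filter_upwards [h0] with x hx
    rw [hx, map_smul, smul_eq_mul]
  have e3 : ∫ x, inner ℝ (H1.fn U x) (H1.fn (testElt _ (hφ.smul_const c)) x) =
      ∫ x, φ x * inner ℝ (H1.fn U x) c := by
    refine integral_congr_ae ?_
    filter_upwards [h0] with x hx
    rw [hx, real_inner_smul_right]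
  simp only [firstVar, e1, e2, e3]

lemma re_nonlin (j : Fin N) (z : Cn N) :
    (nonlin p g j z).re = 1 / p * fderiv ℝ g z (EuclideanSpace.single j 1) := by
  simp [nonlin]
  ring

lemma im_nonlin (j : Fin N) (z : Cn N) :
    (nonlin p g j z).im = 1 / p * fderiv ℝ g z (EuclideanSpace.single j Complex.I) := by
  simp [nonlin]
  ring

lemma integrable_smul_apply {φ : Sp d → ℝ} (hφ : MemLp φ 2 volume) (u : L2 d N) (j : Fin N) :
    Integrable (fun x => φ x • u x j) volume :=
  (PiLp.proj (𝕜 := ℝ) 2 (fun _ : Fin N => ℂ) j).integrable_comp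
    (integrable_smul_L2 hφ u)

lemma integrable_smul_fderiv (hg : Admissible d p g) (hd : 1 ≤ d) {φ : Sp d → ℝ} (hφ : IsTest φ)
    (U : H1 d N) (c : Cn N) : Integrable (fun x => φ x * fderiv ℝ g (H1.fn U x) c) volume := by
  refine (hg.integrable_fderiv hd U (testElt _ (hφ.smul_const c))).congr ?_
  filter_upwards [fn_testElt (hφ.smul_const c)] with x hx
  rw [hx, map_smul, smul_eq_mul]

lemma integrable_smul_nonlin (hg : Admissible d p g) (hd : 1 ≤ d) {φ : Sp d → ℝ} (hφ : IsTest φ)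
    (U : H1 d N) (j : Fin N) : Integrable (fun x => φ x • nonlin p g j (H1.fn U x)) volume := by
  have h1 := (integrable_smul_fderiv hg hd hφ U (EuclideanSpace.single j 1)).const_mul (1 / p)
  have h2 := (integrable_smul_fderiv hg hd hφ U
    (EuclideanSpace.single j Complex.I)).const_mul (1 / p)
  refine (h1.ofReal.add (h2.ofReal.const_mul Complex.I)).congr
    (Filter.Eventually.of_forall fun x => ?_)
  apply Complex.ext
  · rw [Complex.smul_re, re_nonlin]
    simp
    ring
  · rw [Complex.smul_im, im_nonlin]
    simp
    ring

/-- The left hand side minus the right hand side of the `j`-th weak equation. -/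
def weakDefect (p : ℝ) (g : Cn N → ℝ) (ω : ℝ) (U : H1 d N) (j : Fin N) (φ : Sp d → ℝ) : ℂ :=
  (∑ k, ∫ x, pderiv k φ x • H1.partialFn U k x j) + (ω : ℂ) * (∫ x, φ x • H1.fn U x j) +
    ∫ x, φ x • nonlin p g j (H1.fn U x)

/-- One complex equation amounts to two real ones: the real part is the variation in direction `φ
e_j`, and the imaginary part (`im_weakDefect`) that in direction `i φ e_j`. -/
lemma re_weakDefect (hg : Admissible d p g) (hd : 1 ≤ d) {φ : Sp d → ℝ} (hφ : IsTest φ)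
    (U : H1 d N) (j : Fin N) : (weakDefect p g ω U j φ).re =
      firstVar p g ω U (testElt _ (hφ.smul_const (EuclideanSpace.single j 1))) := by
  have h : ∀ f : Sp d → ℂ, Integrable f volume → (∫ x, f x).re = ∫ x, (f x).re :=
    fun f hf => (integral_re hf).symm
  have e1 : ∀ k, (∫ x, pderiv k φ x • H1.partialFn U k x j).re =
      ∫ x, pderiv k φ x * (H1.partialFn U k x j).re := fun k => by
    refine (h _ (integrable_smul_apply (hφ.memLp_pderiv k) (U.1.2 k) j)).trans ?_
    simp only [Complex.smul_re, smul_eq_mul, H1.partialFn]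
  have e2 : (∫ x, φ x • H1.fn U x j).re = ∫ x, φ x * (H1.fn U x j).re := by
    refine (h _ (integrable_smul_apply hφ.memLp U.1.1 j)).trans ?_
    simp only [Complex.smul_re, smul_eq_mul, H1.fn]
  have e3 : (∫ x, φ x • nonlin p g j (H1.fn U x)).re =
      1 / p * ∫ x, φ x * fderiv ℝ g (H1.fn U x) (EuclideanSpace.single j 1) := by
    rw [h _ (integrable_smul_nonlin hg hd hφ U j), ← integral_const_mul]
    simp only [Complex.smul_re, smul_eq_mul, re_nonlin, mul_left_comm _ (1 / p)]
  rw [firstVar_testElt_smul_const hφ, weakDefect, Complex.add_re, Complex.add_re, Complex.re_sum,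
    Complex.re_ofReal_mul, e2, e3]
  simp only [e1, inner_single_one]
  ring

lemma im_weakDefect (hg : Admissible d p g) (hd : 1 ≤ d) {φ : Sp d → ℝ} (hφ : IsTest φ)
    (U : H1 d N) (j : Fin N) : (weakDefect p g ω U j φ).im =
      firstVar p g ω U (testElt _ (hφ.smul_const (EuclideanSpace.single j Complex.I))) := by
  have h : ∀ f : Sp d → ℂ, Integrable f volume → (∫ x, f x).im = ∫ x, (f x).im :=
    fun f hf => (integral_im hf).symm
  have e1 : ∀ k, (∫ x, pderiv k φ x • H1.partialFn U k x j).im =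
      ∫ x, pderiv k φ x * (H1.partialFn U k x j).im := fun k => by
    refine (h _ (integrable_smul_apply (hφ.memLp_pderiv k) (U.1.2 k) j)).trans ?_
    simp only [Complex.smul_im, smul_eq_mul, H1.partialFn]
  have e2 : (∫ x, φ x • H1.fn U x j).im = ∫ x, φ x * (H1.fn U x j).im := by
    refine (h _ (integrable_smul_apply hφ.memLp U.1.1 j)).trans ?_
    simp only [Complex.smul_im, smul_eq_mul, H1.fn]
  have e3 : (∫ x, φ x • nonlin p g j (H1.fn U x)).im =
      1 / p * ∫ x, φ x * fderiv ℝ g (H1.fn U x) (EuclideanSpace.single j Complex.I) := by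
    rw [h _ (integrable_smul_nonlin hg hd hφ U j), ← integral_const_mul]
    simp only [Complex.smul_im, smul_eq_mul, im_nonlin, mul_left_comm _ (1 / p)]
  rw [firstVar_testElt_smul_const hφ, weakDefect, Complex.add_im, Complex.add_im, Complex.im_sum,
    Complex.im_ofReal_mul, e2, e3]
  simp only [e1, inner_single_I]
  ring

/-- The weak equations say that the derivative of the action vanishes on all `φ e_j` and `i φ e_j`.
These span the vector valued test functions, which are dense, and the derivative is continuous. -/
theorem solSet_eq_weakSolSet (hg : Admissible d p g) (hd : 1 ≤ d) (ω : ℝ) :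
    solSet d p g ω = weakSolSet d p g ω := by
  ext U
  rw [mem_solSet_iff hg hd]
  refine and_congr_right fun _ => ⟨fun h j φ hφ => ?_, fun h => ?_⟩
  · have : weakDefect p g ω U j φ = 0 := by
      apply Complex.ext
      · rw [re_weakDefect hg hd hφ, h, Complex.zero_re]
      · rw [im_weakDefect hg hd hφ, h, Complex.zero_im]
    exact eq_neg_of_add_eq_zero_left this
  · obtain ⟨D, hD, -⟩ := exists_hasFDerivAt_action hg hd ω U
    suffices D = 0 by intro V; rw [← hD, this, _root_.zero_apply]
    refine clm_eq_zero_of_testElt D fun φ hφ j => ?_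
    have h0 : weakDefect p g ω U j φ = 0 := by
      rw [weakDefect, h j φ hφ, neg_add_cancel]
    rw [hD, hD, ← re_weakDefect hg hd hφ, ← im_weakDefect hg hd hφ, h0]
    exact ⟨Complex.zero_re, Complex.zero_im⟩

end

noncomputable section

variable {d N : ℕ} {p : ℝ} {g : Cn N → ℝ}

/-! ### Critical points on the unit sphere. -/

section sphere

lemma norm_eq_one_of_mem_bdryB {w : Cn N} (hw : w ∈ bdryB N) : ‖w‖ = 1 := by
  simpa [bdryB] using hw

lemma IsCriticalOnSphere.fderiv_eq_zero {w : Cn N} (hd : Differentiable ℝ g)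
    (h : IsCriticalOnSphere g w) {c : Cn N} (hc : ‖c‖ = 1) (hwc : inner ℝ w c = 0) :
    fderiv ℝ g w c = 0 := by
  have hw := norm_eq_one_of_mem_bdryB h.1
  -- The great circle through `w` with velocity `c`.
  let γ : ℝ → Cn N := fun t => Real.cos t • w + Real.sin t • c
  have h1 : ContDiff ℝ 1 γ :=
    (Real.contDiff_cos.smul contDiff_const).add (Real.contDiff_sin.smul contDiff_const)
  have h2 : ∀ t, γ t ∈ bdryB N := fun t => by
    have : ‖γ t‖ ^ 2 = 1 := by
      rw [norm_add_sq_real, norm_smul, norm_smul, real_inner_smul_left, real_inner_smul_right, hwc,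
        hw, hc, Real.norm_eq_abs, Real.norm_eq_abs, mul_one, mul_one, sq_abs, sq_abs]
      linarith [Real.sin_sq_add_cos_sq t]
    simpa [bdryB] using (pow_eq_one_iff_of_nonneg (norm_nonneg _) two_ne_zero).1 this
  have h3 : γ 0 = w := by simp [γ]
  have h4 : HasDerivAt γ c 0 := by
    have := ((Real.hasDerivAt_cos 0).smul_const w).add ((Real.hasDerivAt_sin 0).smul_const c)
    refine this.congr_deriv ?_
    simp
  have h5 : HasDerivAt (fun t => g (γ t)) (fderiv ℝ g w c) 0 := by
    have hgd : HasFDerivAt g (fderiv ℝ g w) (γ 0) := h3.symm ▸ (hd w).hasFDerivAt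
    exact hgd.comp_hasDerivAt 0 h4
  exact h5.unique (h.2 γ h1 h2 h3)

/-- The Lagrange multiplier rule on the unit sphere. -/
theorem isCriticalOnSphere_iff {d : ℕ} (hg : Admissible d p g) {w : Cn N} (hw : w ∈ bdryB N) :
    IsCriticalOnSphere g w ↔ ∀ c, fderiv ℝ g w c = p * g w * inner ℝ w c := by
  have hw1 := norm_eq_one_of_mem_bdryB hw
  constructor
  · intro h c
    -- The tangential part of `c` contributes nothing; the radial part is evaluated by Euler's
    -- identity.
    set c' := c - (inner ℝ w c : ℝ) • w with hc'
    have horth : inner ℝ w c' = 0 := by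
      rw [hc', inner_sub_right, real_inner_smul_right, real_inner_self_eq_norm_sq, hw1]
      ring
    have h0 : fderiv ℝ g w c' = 0 := by
      rcases eq_or_ne c' 0 with h0 | h0
      · rw [h0, map_zero]
      have hn : ‖c'‖ ≠ 0 := norm_ne_zero_iff.2 h0
      have := h.fderiv_eq_zero hg.differentiable (c := ‖c'‖⁻¹ • c')
        (by rw [norm_smul, norm_inv, norm_norm, inv_mul_cancel₀ hn])
        (by rw [real_inner_smul_right, horth, mul_zero])
      rw [map_smul, smul_eq_mul] at this
      exact (mul_eq_zero.1 this).resolve_left (inv_ne_zero hn)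
    rw [hc', map_sub, map_smul, hg.fderiv_self, smul_eq_mul] at h0
    linarith
  · intro h
    refine ⟨hw, fun γ h1 h2 h3 => ?_⟩
    have hd : HasDerivAt γ (deriv γ 0) 0 := (h1.differentiable one_ne_zero 0).hasDerivAt
    have hin : inner ℝ w (deriv γ 0) = 0 := by
      have hns := hd.norm_sq
      have hc : (fun t => ‖γ t‖ ^ 2) = fun _ => (1 : ℝ) := funext fun t => by
        rw [norm_eq_one_of_mem_bdryB (h2 t), one_pow]
      rw [hc, h3] at hns
      have := hns.unique (hasDerivAt_const (0 : ℝ) (1 : ℝ))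
      linarith
    have hgd : HasFDerivAt g (fderiv ℝ g w) (γ 0) :=
      h3.symm ▸ (hg.differentiable w).hasFDerivAt
    have := hgd.comp_hasDerivAt 0 hd
    rwa [h, hin, mul_zero] at this

lemma exists_minimizer_on_sphere {d : ℕ} (hg : Admissible d p g) {w : Cn N} (hw : w ∈ bdryB N) :
    ∃ w₀ ∈ bdryB N, g w₀ = gMin g ∧ g w₀ ≤ g w ∧ IsCriticalOnSphere g w₀ := by
  have hcont : Continuous g := hg.contDiff.continuous
  have hcpt : IsCompact (bdryB N) := isCompact_sphere _ _
  obtain ⟨w₀, h0, hmin⟩ := hcpt.exists_isMinOn ⟨w, hw⟩ hcont.continuousOn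
  refine ⟨w₀, h0, ?_, hmin hw, h0, fun γ h1 h2 h3 => ?_⟩
  · refine (IsLeast.csInf_eq ⟨Set.mem_image_of_mem g h0, ?_⟩).symm
    rintro _ ⟨z, hz, rfl⟩
    exact hmin hz
  · have hd : HasDerivAt γ (deriv γ 0) 0 := (h1.differentiable one_ne_zero 0).hasDerivAt
    have hgd : HasFDerivAt g (fderiv ℝ g w₀) (γ 0) :=
      h3.symm ▸ (hg.differentiable w₀).hasFDerivAt
    have hder := hgd.comp_hasDerivAt 0 hd
    have hloc : IsLocalMin (g ∘ γ) 0 := Filter.Eventually.of_forall fun t => by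
      simp only [Function.comp_apply, h3]
      exact hmin (h2 t)
    rw [hloc.hasDerivAt_eq_zero hder] at hder
    exact hder

lemma clm_eq_of_single {L L' : Cn N →L[ℝ] ℝ}
    (h1 : ∀ j, L (EuclideanSpace.single j 1) = L' (EuclideanSpace.single j 1))
    (h2 : ∀ j, L (EuclideanSpace.single j Complex.I) = L' (EuclideanSpace.single j Complex.I)) :
    L = L' := by
  ext z
  rw [eq_sum_re_im_smul_single z]
  simp only [map_sum, map_add, map_smul, h1, h2]

/-- The algebraic equation satisfied by the direction of a scalar solution. -/
theorem nonlin_eq_iff_isCriticalOnSphere {d : ℕ} (hg : Admissible d p g) {w : Cn N}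
    (hw : w ∈ bdryB N) (a : ℝ) :
    (∀ j, nonlin p g j w = -(a : ℂ) * w j) ↔ IsCriticalOnSphere g w ∧ a = -g w := by
  have hp : p ≠ 0 := by linarith [hg.two_lt]
  have hw1 := norm_eq_one_of_mem_bdryB hw
  rw [isCriticalOnSphere_iff hg hw]
  constructor
  · intro h
    have hL : fderiv ℝ g w = (-(p * a)) • innerSL ℝ w := by
      refine clm_eq_of_single (fun j => ?_) fun j => ?_
      · have := congrArg Complex.re (h j)
        rw [re_nonlin, ← Complex.ofReal_neg, Complex.re_ofReal_mul] at this
        rw [_root_.smul_apply, innerSL_apply_apply, inner_single_one, smul_eq_mul]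
        field_simp at this
        linarith
      · have := congrArg Complex.im (h j)
        rw [im_nonlin, ← Complex.ofReal_neg, Complex.im_ofReal_mul] at this
        rw [_root_.smul_apply, innerSL_apply_apply, inner_single_I, smul_eq_mul]
        field_simp at this
        linarith
    have hc : ∀ c, fderiv ℝ g w c = -(p * a) * inner ℝ w c := fun c => by
      rw [hL, _root_.smul_apply, innerSL_apply_apply, smul_eq_mul]
    -- Pairing with `w` itself and using Euler's identity identifies the multiplier.
    have ha : a = -g w := by
      have := hc w
      rw [hg.fderiv_self, real_inner_self_eq_norm_sq, hw1] at this
      have h2 : p * (g w + a) = 0 := by linarith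
      linarith [(mul_eq_zero.1 h2).resolve_left hp]
    exact ⟨fun c => by rw [hc, ha]; ring, ha⟩
  · rintro ⟨h, ha⟩ j
    apply Complex.ext
    · rw [re_nonlin, h, inner_single_one, ← Complex.ofReal_neg, Complex.re_ofReal_mul, ha]
      field_simp
    · rw [im_nonlin, h, inner_single_I, ← Complex.ofReal_neg, Complex.im_ofReal_mul, ha]
      field_simp

end sphere

/-! ### Scalar profiles: rescaling, and insertion in the system. -/

/-- A positive solution `q ∈ H¹` of `-Δq + ω q = a q^{p-1}` with weak gradient `Dq`. -/
structure IsProfile (p ω a : ℝ) (q : Sp d → ℝ) (Dq : Fin d → Sp d → ℝ) : Prop where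
  pos : ∀ x, 0 < q x
  memLp : MemLp q 2 volume
  memLp_partial : ∀ k, MemLp (Dq k) 2 volume
  isWeakPartial : ∀ k, IsWeakPartial k q (Dq k)
  weak_eq : ∀ φ : Sp d → ℝ, IsTest φ →
    (∑ k, ∫ x, pderiv k φ x * Dq k x) + ω * ∫ x, φ x * q x = a * ∫ x, φ x * q x ^ (p - 1)

section scaling

variable {s : ℝ} (hs : 0 < s) (y : Sp d)
include hs

lemma integral_comp_smul_sub {F : Type*} [NormedAddCommGroup F] [NormedSpace ℝ F]
    (f : Sp d → F) : ∫ x, f (s • (x - y)) = (s ^ d)⁻¹ • ∫ x, f x := by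
  rw [integral_sub_right_eq_self (fun x => f (s • x)) y, Measure.integral_comp_smul,
    finrank_euclideanSpace_fin, abs_of_pos (by positivity)]

lemma memLp_comp_smul_sub {F : Type*} [NormedAddCommGroup F] {f : Sp d → F}
    (hf : MemLp f 2 volume) : MemLp (fun x => f (s • (x - y))) 2 volume := by
  have h1 : MemLp (fun x => f (s • x)) 2 (volume : Measure (Sp d)) := by
    refine MemLp.comp_of_map (g := f) (f := fun x : Sp d => s • x) ?_
      (measurable_const_smul s).aemeasurable
    rw [Measure.map_addHaar_smul _ hs.ne']
    exact hf.smul_measure ENNReal.ofReal_ne_top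
  exact h1.comp_measurePreserving (measurePreserving_sub_right volume y)

/-- Moves the affine map onto the test function: with `ψ(z) = φ(z/s + y)`, a change of variables
turns identities for the rescaled profile into identities for `Q`. -/
lemma exists_isTest_comp {φ : Sp d → ℝ} (hφ : IsTest φ) : ∃ ψ : Sp d → ℝ, IsTest ψ ∧
    (∀ x, φ x = ψ (s • (x - y))) ∧ ∀ k x, pderiv k φ x = s * pderiv k ψ (s • (x - y)) := by
  have hsmooth : ContDiff ℝ (⊤ : ℕ∞) fun z : Sp d => s⁻¹ • z + y :=
    (contDiff_const_smul _).add contDiff_const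
  have hψ : IsTest fun z => φ (s⁻¹ • z + y) := by
    refine ⟨hφ.1.comp hsmooth, ?_⟩
    exact hφ.2.comp_homeomorph ((Homeomorph.smulOfNeZero s⁻¹ (inv_ne_zero hs.ne')).trans
      (Homeomorph.addRight y))
  have h1 : ∀ x, φ x = φ (s⁻¹ • (s • (x - y)) + y) := fun x => by
    rw [smul_smul, inv_mul_cancel₀ hs.ne', one_smul, sub_add_cancel]
  refine ⟨_, hψ, h1, fun k x => ?_⟩
  set ψ := fun z => φ (s⁻¹ • z + y) with hψd
  have hd : HasFDerivAt (fun x => ψ (s • (x - y)))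
      ((fderiv ℝ ψ (s • (x - y))).comp (s • ContinuousLinearMap.id ℝ (Sp d))) x :=
    (hψ.1.differentiable (by simp) _).hasFDerivAt.comp x
      (((hasFDerivAt_id x).sub_const y).const_smul s)
  have hfun : φ = fun x => ψ (s • (x - y)) := funext h1
  conv_lhs => rw [hfun]
  rw [pderiv, hd.fderiv]
  simp [pderiv]

end scaling

/-- The rescaled gradient `∇ Q_{ω,a}`. -/
def scaledDQ (p : ℝ) (DQ : Fin d → Sp d → ℝ) (ω a : ℝ) (k : Fin d) (x : Sp d) : ℝ :=
  (ω / a) ^ (1 / (p - 2)) * (Real.sqrt ω * DQ k (Real.sqrt ω • x))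

/-- The amplitude `l` satisfies `l^{p-2} = ω/a`, that is `a l^{p-1} = ω l`. With `s² = ω`, every
term of the equation then acquires the same factor `s^{-d} l ω`. -/
theorem isProfile_scaledQ {Q : Sp d → ℝ} (hp : 2 < p) (hQ : IsPositiveRadialSolution p Q)
    {DQ : Fin d → Sp d → ℝ} (hDQ : ∀ k, MemLp (DQ k) 2 volume ∧ IsWeakPartial k Q (DQ k))
    (hw : ∀ φ : Sp d → ℝ, IsTest φ →
      (∑ k, ∫ x, DQ k x * pderiv k φ x) + ∫ x, Q x * φ x = ∫ x, Q x ^ (p - 1) * φ x)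
    {ω a : ℝ} (hω : 0 < ω) (ha : 0 < a) (y : Sp d) :
    IsProfile p ω a (fun x => scaledQ p Q ω a (x - y))
      (fun k x => scaledDQ p DQ ω a k (x - y)) := by
  set l := (ω / a) ^ (1 / (p - 2)) with hl
  set s := Real.sqrt ω with hsd
  have hs : 0 < s := Real.sqrt_pos.2 hω
  have hss : s * s = ω := Real.mul_self_sqrt hω.le
  have hl0 : 0 < l := by positivity
  have hlp : l ^ (p - 1) = l * (ω / a) := by
    have h1 : l ^ (p - 2) = ω / a := by
      rw [hl, ← Real.rpow_mul (by positivity), one_div_mul_cancel (by linarith), Real.rpow_one]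
    rw [show p - 1 = 1 + (p - 2) by ring, Real.rpow_add hl0, h1, Real.rpow_one]
  have hq : ∀ x, scaledQ p Q ω a x = l * Q (s • x) := fun x => rfl
  have hDq : ∀ k x, scaledDQ p DQ ω a k x = l * (s * DQ k (s • x)) := fun k x => rfl
  refine ⟨fun x => mul_pos hl0 (hQ.pos _), ?_, fun k => ?_, fun k φ hφ => ?_, fun φ hφ => ?_⟩
  · exact (memLp_comp_smul_sub hs y hQ.memLp).const_mul l
  · exact ((memLp_comp_smul_sub hs y (hDQ k).1).const_mul s).const_mul l
  · obtain ⟨ψ, hψ, h1, h2⟩ := exists_isTest_comp hs y hφ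
    simp only [h1, h2, hq, hDq, smul_eq_mul]
    have e1 := integral_comp_smul_sub hs y fun z => s * pderiv k ψ z * (l * Q z)
    have e2 := integral_comp_smul_sub hs y fun z => ψ z * (l * (s * DQ k z))
    have key := (hDQ k).2 ψ hψ
    simp only [smul_eq_mul] at key e1 e2
    rw [e1, e2]
    have f1 : ∫ z, s * pderiv k ψ z * (l * Q z) = s * l * ∫ z, pderiv k ψ z * Q z := by
      rw [← integral_const_mul]; congr 1; funext z; ring
    have f2 : ∫ z, ψ z * (l * (s * DQ k z)) = s * l * ∫ z, ψ z * DQ k z := by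
      rw [← integral_const_mul]; congr 1; funext z; ring
    rw [f1, f2, key]
    ring
  · obtain ⟨ψ, hψ, h1, h2⟩ := exists_isTest_comp hs y hφ
    simp only [h1, h2, hq, hDq]
    have key := hw ψ hψ
    have e1 : ∀ k, ∫ x, s * pderiv k ψ (s • (x - y)) * (l * (s * DQ k (s • (x - y)))) =
        (s ^ d)⁻¹ * (l * ω) * ∫ z, DQ k z * pderiv k ψ z := fun k => by
      have := integral_comp_smul_sub hs y fun z => s * pderiv k ψ z * (l * (s * DQ k z))
      rw [this, smul_eq_mul, mul_assoc, ← integral_const_mul (l * ω), ← hss]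
      congr 2; funext z; ring
    have e2 : ∫ x, ψ (s • (x - y)) * (l * Q (s • (x - y))) =
        (s ^ d)⁻¹ * l * ∫ z, Q z * ψ z := by
      have := integral_comp_smul_sub hs y fun z => ψ z * (l * Q z)
      rw [this, smul_eq_mul, mul_assoc, ← integral_const_mul l]
      congr 2; funext z; ring
    have e3 : ∫ x, ψ (s • (x - y)) * (l * Q (s • (x - y))) ^ (p - 1) =
        (s ^ d)⁻¹ * (l * (ω / a)) * ∫ z, Q z ^ (p - 1) * ψ z := by
      have := integral_comp_smul_sub hs y fun z => ψ z * (l * Q z) ^ (p - 1)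
      rw [this, smul_eq_mul, mul_assoc, ← integral_const_mul (l * (ω / a))]
      congr 2; funext z
      rw [Real.mul_rpow hl0.le (hQ.pos z).le, hlp]
      ring
    simp only [e1]
    rw [e2, e3, ← key, ← Finset.mul_sum]
    field_simp

namespace IsProfile

variable {ω a : ℝ} {q : Sp d → ℝ} {Dq : Fin d → Sp d → ℝ} (hq : IsProfile p ω a q Dq)
include hq

/-- The element `q w` of `H¹` built from a scalar profile. -/
lemma exists_elt (w : Cn N) : ∃ U : H1 d N, H1.fn U =ᵐ[volume] (fun x => q x • w) ∧
    ∀ k, H1.partialFn U k =ᵐ[volume] fun x => Dq k x • w := by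
  have hwp : ∀ k, IsWeakPartial k (fun x => q x • w) (fun x => Dq k x • w) := by
    intro k φ hφ
    have := hq.isWeakPartial k φ hφ
    simp only [smul_smul, integral_smul_const]
    simp only [smul_eq_mul] at this
    rw [this, neg_smul]
  have hm : ∀ {f : Sp d → ℝ}, MemLp f 2 volume → MemLp (fun x => f x • w) 2 volume := by
    intro f hf
    have := (ContinuousLinearMap.toSpanSingleton ℝ w).comp_memLp' hf
    simpa [Function.comp_def] using this
  exact ⟨H1.ofFunctions _ _ (hm hq.memLp) (fun k => hm (hq.memLp_partial k)) hwp,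
    H1.fn_ofFunctions _ _ _, H1.partialFn_ofFunctions _ _ _⟩

lemma partialFn_ae {w : Cn N} {U : H1 d N} (hU : H1.fn U =ᵐ[volume] fun x => q x • w)
    (k : Fin d) : H1.partialFn U k =ᵐ[volume] fun x => Dq k x • w := by
  obtain ⟨V, hV, hVp⟩ := hq.exists_elt w
  rw [H1.ext_fn (hU.trans hV.symm)]
  exact hVp k

/-- The profile equation replaces the linear terms by `a q^{p-1} w_j`, and positivity of `q` with
homogeneity gives `F_j(q w) = q^{p-1} F_j(w)`. The system thus collapses to an algebraic condition
on `w`. -/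
lemma weakDefect_eq (hg : Admissible d p g) {w : Cn N} {U : H1 d N}
    (hU : H1.fn U =ᵐ[volume] fun x => q x • w) (j : Fin N) {φ : Sp d → ℝ} (hφ : IsTest φ) :
    weakDefect p g ω U j φ =
      ((∫ x, φ x * q x ^ (p - 1) : ℝ) : ℂ) * ((a : ℂ) * w j + nonlin p g j w) := by
  have e1 : ∀ k, ∫ x, pderiv k φ x • H1.partialFn U k x j =
      ((∫ x, pderiv k φ x * Dq k x : ℝ) : ℂ) * w j := fun k => by
    rw [← integral_complex_ofReal, ← integral_mul_const]
    refine integral_congr_ae ?_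
    filter_upwards [hq.partialFn_ae hU k] with x hx
    rw [hx, PiLp.smul_apply, Complex.real_smul, Complex.real_smul]
    push_cast
    ring
  have e2 : ∫ x, φ x • H1.fn U x j = ((∫ x, φ x * q x : ℝ) : ℂ) * w j := by
    rw [← integral_complex_ofReal, ← integral_mul_const]
    refine integral_congr_ae ?_
    filter_upwards [hU] with x hx
    rw [hx, PiLp.smul_apply, Complex.real_smul, Complex.real_smul]
    push_cast
    ring
  have hF : ∀ x, nonlin p g j (q x • w) = ((q x ^ (p - 1) : ℝ) : ℂ) * nonlin p g j w := by
    intro x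
    rw [nonlin, hg.fderiv_smul (hq.pos x), _root_.smul_apply, _root_.smul_apply, nonlin]
    push_cast [smul_eq_mul]
    ring
  have e3 : ∫ x, φ x • nonlin p g j (H1.fn U x) =
      ((∫ x, φ x * q x ^ (p - 1) : ℝ) : ℂ) * nonlin p g j w := by
    rw [← integral_complex_ofReal, ← integral_mul_const]
    refine integral_congr_ae ?_
    filter_upwards [hU] with x hx
    rw [hx, hF, Complex.real_smul]
    push_cast
    ring
  rw [weakDefect, e2, e3]
  simp only [e1]
  rw [← Finset.sum_mul, mul_add, ← mul_assoc, ← mul_assoc, ← add_mul]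
  congr 2
  rw [mul_comm _ (a : ℂ)]
  exact_mod_cast hq.weak_eq φ hφ

/-- Any bump function serves. Integrability, without which the integral would be zero by convention,
comes from `b q^{p-1} ≤ q^p + b^p` and the Sobolev embedding for `q w`. -/
lemma exists_integral_pos (hg : Admissible d p g) (hd : 1 ≤ d) {w : Cn N} (hw : ‖w‖ = 1)
    {U : H1 d N} (hU : H1.fn U =ᵐ[volume] fun x => q x • w) :
    ∃ φ : Sp d → ℝ, IsTest φ ∧ 0 < ∫ x, φ x * q x ^ (p - 1) := by
  have hp := hg.two_lt
  let b : ContDiffBump (0 : Sp d) := ⟨1, 2, one_pos, one_lt_two⟩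
  have hb : IsTest b := ⟨b.contDiff, b.hasCompactSupport⟩
  have hqp : Integrable (fun x => q x ^ p) volume := by
    refine (hg.integrable_norm_rpow hd U).congr ?_
    filter_upwards [hU] with x hx
    rw [hx, norm_smul, hw, mul_one, Real.norm_of_nonneg (hq.pos x).le]
  have hbp : Integrable (fun x => b x ^ p) volume := by
    refine Continuous.integrable_of_hasCompactSupport
      (b.continuous.rpow_const fun x => Or.inr (by linarith)) ?_
    exact b.hasCompactSupport.comp_left (g := fun t : ℝ => t ^ p) (Real.zero_rpow (by linarith))
  have hi : Integrable (fun x => b x * q x ^ (p - 1)) volume := by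
    refine (hqp.add hbp).mono' (b.continuous.aestronglyMeasurable.mul
      (hq.memLp.1.aemeasurable.pow_const _).aestronglyMeasurable)
      (Filter.Eventually.of_forall fun x => ?_)
    rw [Real.norm_of_nonneg (mul_nonneg b.nonneg (Real.rpow_nonneg (hq.pos x).le _)), mul_comm]
    exact rpow_sub_one_mul_le hp (hq.pos x).le b.nonneg
  refine ⟨b, hb, ?_⟩
  rw [integral_pos_iff_support_of_nonneg
    (fun x => mul_nonneg b.nonneg (Real.rpow_nonneg (hq.pos x).le _)) hi]
  have hsupp : Function.support (fun x => b x * q x ^ (p - 1)) = Metric.ball 0 2 := by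
    rw [← b.support_eq]
    ext x
    simp [(Real.rpow_pos_of_pos (hq.pos x) _).ne']
  rw [hsupp]
  exact Metric.measure_ball_pos _ _ two_pos

lemma ne_zero {w : Cn N} (hw : ‖w‖ = 1) {U : H1 d N}
    (hU : H1.fn U =ᵐ[volume] fun x => q x • w) : U ≠ 0 := by
  rintro rfl
  obtain ⟨x, hx1, hx2⟩ := (hU.and H1.fn_zero).exists
  rw [hx1, Pi.zero_apply, smul_eq_zero] at hx2
  rcases hx2 with h | h
  · exact (hq.pos x).ne' h
  · rw [h, norm_zero] at hw; exact zero_ne_one hw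

theorem mem_weakSolSet_iff (hg : Admissible d p g) (hd : 1 ≤ d) {w : Cn N} (hw : w ∈ bdryB N)
    {U : H1 d N} (hU : H1.fn U =ᵐ[volume] fun x => q x • w) :
    U ∈ weakSolSet d p g ω ↔ IsCriticalOnSphere g w ∧ a = -g w := by
  have hw1 := norm_eq_one_of_mem_bdryB hw
  rw [← nonlin_eq_iff_isCriticalOnSphere hg hw]
  constructor
  · rintro ⟨-, h⟩ j
    obtain ⟨φ, hφ, hpos⟩ := hq.exists_integral_pos hg hd hw1 hU
    have h0 : weakDefect p g ω U j φ = 0 := by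
      rw [weakDefect, h j φ hφ, neg_add_cancel]
    rw [hq.weakDefect_eq hg hU j hφ] at h0
    have := (mul_eq_zero.1 h0).resolve_left (by exact_mod_cast hpos.ne')
    rw [eq_neg_of_add_eq_zero_right this, neg_mul]
  · intro h
    refine ⟨hq.ne_zero hw1 hU, fun j φ hφ => ?_⟩
    have h0 : weakDefect p g ω U j φ = 0 := by
      rw [hq.weakDefect_eq hg hU j hφ, h j]
      ring
    exact eq_neg_of_add_eq_zero_left h0

end IsProfile

/-! ### Comparison of actions, and the two conclusions. -/

/-- The quadratic part `∑ ∫ |∇u|² + ω ∫ |u|²` of the action. -/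
def quadPart (ω : ℝ) (U : H1 d N) : ℝ :=
  (∑ k, ∫ x, ‖H1.partialFn U k x‖ ^ 2) + ω * ∫ x, ‖H1.fn U x‖ ^ 2

lemma firstVar_self (hg : Admissible d p g) (ω : ℝ) (U : H1 d N) :
    firstVar p g ω U U = quadPart ω U + ∫ x, g (H1.fn U x) := by
  have hp : p ≠ 0 := by linarith [hg.two_lt]
  simp only [firstVar, quadPart, real_inner_self_eq_norm_sq, hg.fderiv_self]
  rw [integral_const_mul, ← mul_assoc, one_div_mul_cancel hp]
  ring

lemma action_eq (ω : ℝ) (U : H1 d N) :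
    action p g ω U = 1 / 2 * quadPart ω U + 1 / p * ∫ x, g (H1.fn U x) := by
  simp only [action, energy, mass, quadPart, integral_const_mul, ← Finset.mul_sum]
  ring

/-- Pairing the equation with `U` gives the Nehari identity, which eliminates `∫ g(u)` from the
action. -/
lemma action_eq_of_mem_solSet (hg : Admissible d p g) (hd : 1 ≤ d) {ω : ℝ} {U : H1 d N}
    (hU : U ∈ solSet d p g ω) : action p g ω U = (1 / 2 - 1 / p) * quadPart ω U := by
  have h := ((mem_solSet_iff hg hd).1 hU).2 U
  rw [firstVar_self hg] at h
  rw [action_eq, show ∫ x, g (H1.fn U x) = -quadPart ω U by linarith]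
  ring

lemma integral_norm_sq_pos {U : H1 d N} (hU : U ≠ 0) : 0 < ∫ x, ‖H1.fn U x‖ ^ 2 := by
  have h : ∫ x, ‖H1.fn U x‖ ^ 2 = ‖U.1.1‖ ^ 2 := by
    have := integral_half_norm_sq U.1.1
    rw [integral_const_mul] at this
    exact mul_left_cancel₀ (by norm_num) this
  rw [h]
  refine pow_pos (norm_pos_iff.2 fun h0 => hU (H1.ext_fn ?_)) 2
  have : H1.fn U = H1.fn (0 : H1 d N) := by
    change ((U.1.1 : L2 d N) : Sp d → Cn N) = ((0 : L2 d N) : Sp d → Cn N)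
    rw [h0]
  exact Filter.EventuallyEq.of_eq this

lemma quadPart_pos {ω : ℝ} (hω : 0 < ω) {U : H1 d N} (hU : U ≠ 0) : 0 < quadPart ω U :=
  add_pos_of_nonneg_of_pos
    (Finset.sum_nonneg fun _ _ => integral_nonneg fun _ => by positivity)
    (mul_pos hω (integral_norm_sq_pos hU))

/-- A nonzero critical point of the action determines its frequency. -/
lemma frequency_unique (hg : Admissible d p g) (hd : 1 ≤ d) {ω ω' : ℝ} {U : H1 d N}
    (h : U ∈ solSet d p g ω) (h' : U ∈ solSet d p g ω') : ω = ω' := by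
  have e := ((mem_solSet_iff hg hd).1 h).2 U
  have e' := ((mem_solSet_iff hg hd).1 h').2 U
  rw [firstVar_self hg, quadPart] at e e'
  have : (ω - ω') * ∫ x, ‖H1.fn U x‖ ^ 2 = 0 := by linarith
  linarith [(mul_eq_zero.1 this).resolve_right (integral_norm_sq_pos h.1).ne']

lemma quadPart_eq_of_profile {ω a : ℝ} {q : Sp d → ℝ} {Dq : Fin d → Sp d → ℝ}
    (hq : IsProfile p ω a q Dq) {w : Cn N} (hw : ‖w‖ = 1) {U : H1 d N}
    (hU : H1.fn U =ᵐ[volume] fun x => q x • w) :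
    quadPart ω U = (∑ k, ∫ x, Dq k x ^ 2) + ω * ∫ x, q x ^ 2 := by
  have e1 : ∀ k, ∫ x, ‖H1.partialFn U k x‖ ^ 2 = ∫ x, Dq k x ^ 2 := fun k => by
    refine integral_congr_ae ?_
    filter_upwards [hq.partialFn_ae hU k] with x hx
    rw [hx, norm_smul, hw, mul_one, Real.norm_eq_abs, sq_abs]
  have e2 : ∫ x, ‖H1.fn U x‖ ^ 2 = ∫ x, q x ^ 2 := by
    refine integral_congr_ae ?_
    filter_upwards [hU] with x hx
    rw [hx, norm_smul, hw, mul_one, Real.norm_eq_abs, sq_abs]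
  simp only [quadPart, e1, e2]

/-- The unit vectors drop out and both sides are the same integral times the squared amplitude
`(ω/b)^{2/(p-2)}`, decreasing in `b`. Strictness needs the common integral to be positive, which
follows from `U ≠ 0`. -/
lemma quadPart_lt_of_lt {Q : Sp d → ℝ} {DQ : Fin d → Sp d → ℝ} {ω a a₀ : ℝ} {y : Sp d}
    (hp : 2 < p) (hω : 0 < ω) (ha : 0 < a) (haa : a < a₀)
    (hq : IsProfile p ω a (fun x => scaledQ p Q ω a (x - y))
      (fun k x => scaledDQ p DQ ω a k (x - y)))
    (hq₀ : IsProfile p ω a₀ (fun x => scaledQ p Q ω a₀ (x - y))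
      (fun k x => scaledDQ p DQ ω a₀ k (x - y)))
    {w w₀ : Cn N} (hw : ‖w‖ = 1) (hw₀ : ‖w₀‖ = 1) {U U₀ : H1 d N}
    (hU : H1.fn U =ᵐ[volume] fun x => scaledQ p Q ω a (x - y) • w)
    (hU₀ : H1.fn U₀ =ᵐ[volume] fun x => scaledQ p Q ω a₀ (x - y) • w₀) :
    quadPart ω U₀ < quadPart ω U := by
  have hpos := quadPart_pos hω (hq.ne_zero hw hU)
  rw [quadPart_eq_of_profile hq hw hU] at hpos ⊢
  rw [quadPart_eq_of_profile hq₀ hw₀ hU₀]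
  have ha₀ : 0 < a₀ := ha.trans haa
  have e : ∀ b : ℝ, (∑ k, ∫ x, scaledDQ p DQ ω b k (x - y) ^ 2) +
      ω * ∫ x, scaledQ p Q ω b (x - y) ^ 2 = ((ω / b) ^ (1 / (p - 2))) ^ 2 *
      ((∑ k, ∫ x, (Real.sqrt ω * DQ k (Real.sqrt ω • (x - y))) ^ 2) +
        ω * ∫ x, Q (Real.sqrt ω • (x - y)) ^ 2) := by
    intro b
    simp only [scaledDQ, scaledQ, mul_pow, integral_const_mul, ← Finset.mul_sum]
    ring
  rw [e a] at hpos
  rw [e a, e a₀]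
  have hl : 0 < ((ω / a) ^ (1 / (p - 2))) ^ 2 := by positivity
  refine mul_lt_mul_of_pos_right ?_ ((mul_pos_iff_of_pos_left hl).1 hpos)
  have : (ω / a₀) ^ (1 / (p - 2)) < (ω / a) ^ (1 / (p - 2)) :=
    Real.rpow_lt_rpow (by positivity) (div_lt_div_of_pos_left hω ha haa)
      (one_div_pos.2 (by linarith))
  exact pow_lt_pow_left₀ this (by positivity) two_ne_zero

/-- The scalar solutions over a direction `w` solve the system iff `w` is critical on the
sphere. -/
theorem scalarFamily_subset_weakSolSet_iff (hd : 1 ≤ d) (hg : Admissible d p g) {Q : Sp d → ℝ}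
    (hQ : IsPositiveRadialSolution p Q) {w : Cn N} (hw : w ∈ bdryB N) {a : ℝ} (ha : 0 < a) :
    (∀ ω : ℝ, 0 < ω → scalarFamily p Q w ω a ⊆ functionsOf (weakSolSet d p g ω)) ↔
      (IsCriticalOnSphere g w ∧ a = -g w ∧ 0 < -g w) := by
  obtain ⟨DQ, hDQ, hwk⟩ := hQ.weak_solution
  constructor
  · intro h
    -- A single member of the families, with `ω = 1` and centre `0`, already forces the condition on
    -- `w` and `a`.
    obtain ⟨U, hUs, hU⟩ := h 1 one_pos ⟨0, rfl⟩
    have := ((isProfile_scaledQ hg.two_lt hQ hDQ hwk one_pos ha 0).mem_weakSolSet_iff hg hd hw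
      hU).1 hUs
    exact ⟨this.1, this.2, this.2 ▸ ha⟩
  · rintro ⟨h1, h2, -⟩ ω hω _ ⟨y, rfl⟩
    have hq := isProfile_scaledQ hg.two_lt hQ hDQ hwk hω ha y
    obtain ⟨U, hU, -⟩ := hq.exists_elt w
    exact ⟨U, (hq.mem_weakSolSet_iff hg hd hw hU).2 ⟨h1, h2⟩, hU⟩

theorem scalarFamily_subset_excitedSet (hd : 1 ≤ d) (hg : Admissible d p g) {Q : Sp d → ℝ}
    (hQ : IsPositiveRadialSolution p Q) {w : Cn N} (hc : IsCriticalOnSphere g w)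
    (hneg : g w < 0) (hne : g w ≠ gMin g) {ω : ℝ} (hω : 0 < ω) :
    scalarFamily p Q w ω (-g w) ⊆ functionsOf (solSet d p g ω ∩ excitedSet d p g) := by
  obtain ⟨DQ, hDQ, hwk⟩ := hQ.weak_solution
  have hp := hg.two_lt
  rintro _ ⟨y, rfl⟩
  have ha : 0 < -g w := neg_pos.2 hneg
  have hq := isProfile_scaledQ hp hQ hDQ hwk hω ha y
  obtain ⟨U, hU, -⟩ := hq.exists_elt w
  have hUs : U ∈ solSet d p g ω := by
    rw [solSet_eq_weakSolSet hg hd]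
    exact (hq.mem_weakSolSet_iff hg hd hc.1 hU).2 ⟨hc, rfl⟩
  refine ⟨U, ⟨hUs, Set.mem_iUnion₂.2 ⟨ω, hω, hUs⟩, fun hG => ?_⟩, hU⟩
  obtain ⟨ω', -, hG'⟩ := Set.mem_iUnion₂.1 hG
  -- Being a ground state at some `ω'` forces `ω' = ω`, so it suffices to find a solution of smaller
  -- action at this frequency. The scalar one over a minimizer of `g` serves, and no existence of
  -- ground states is needed.
  obtain rfl := frequency_unique hg hd hUs hG'.1
  obtain ⟨w₀, hw₀, hmin, hle, hcrit⟩ := exists_minimizer_on_sphere hg hc.1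
  have hlt : -g w < -g w₀ := neg_lt_neg (lt_of_le_of_ne hle fun h => hne (h ▸ hmin))
  have hq₀ := isProfile_scaledQ hp hQ hDQ hwk hω (ha.trans hlt) y
  obtain ⟨U₀, hU₀, -⟩ := hq₀.exists_elt w₀
  have hUs₀ : U₀ ∈ solSet d p g ω := by
    rw [solSet_eq_weakSolSet hg hd]
    exact (hq₀.mem_weakSolSet_iff hg hd hw₀ hU₀).2 ⟨hcrit, rfl⟩
  have hge := hG'.2.1 (Set.mem_image_of_mem _ hUs₀)
  rw [action_eq_of_mem_solSet hg hd hUs, action_eq_of_mem_solSet hg hd hUs₀] at hge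
  have hcoef : 0 < 1 / 2 - 1 / p := sub_pos.2 (one_div_lt_one_div_of_lt two_pos hp)
  exact absurd (le_of_mul_le_mul_left hge hcoef) (not_le.2 (quadPart_lt_of_lt hp hω ha hlt hq hq₀
    (norm_eq_one_of_mem_bdryB hc.1) (norm_eq_one_of_mem_bdryB hw₀) hU hU₀))

end

end ScalarSolitons

theorem theorem1p2 (d N : ℕ) (hd : 1 ≤ d) (hN : 2 ≤ N) (p : ℝ)
    (g : ScalarSolitons.Cn N → ℝ) (hg : ScalarSolitons.Admissible d p g)
    (Q : ScalarSolitons.Sp d → ℝ) (hQ : ScalarSolitons.IsPositiveRadialSolution p Q)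
    (w : ScalarSolitons.Cn N) (hw : w ∈ ScalarSolitons.bdryB N) :
    (∀ a : ℝ, 0 < a →
      ((∀ ω : ℝ, 0 < ω → ScalarSolitons.scalarFamily p Q w ω a ⊆
          ScalarSolitons.functionsOf (ScalarSolitons.solSet d p g ω)) ↔
        (ScalarSolitons.IsCriticalOnSphere g w ∧ a = -g w ∧ 0 < -g w)) ∧
      ((∀ ω : ℝ, 0 < ω → ScalarSolitons.scalarFamily p Q w ω a ⊆
          ScalarSolitons.functionsOf (ScalarSolitons.weakSolSet d p g ω)) ↔
        (ScalarSolitons.IsCriticalOnSphere g w ∧ a = -g w ∧ 0 < -g w))) ∧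
    (ScalarSolitons.IsCriticalOnSphere g w → g w < 0 → g w ≠ ScalarSolitons.gMin g →
      ∀ ω : ℝ, 0 < ω → ScalarSolitons.scalarFamily p Q w ω (-g w) ⊆
        ScalarSolitons.functionsOf
          (ScalarSolitons.solSet d p g ω ∩ ScalarSolitons.excitedSet d p g)) := by
  refine ⟨fun a ha => ?_, fun hc hneg hne ω hω =>
    ScalarSolitons.scalarFamily_subset_excitedSet hd hg hQ hc hneg hne hω⟩
  have h := ScalarSolitons.scalarFamily_subset_weakSolSet_iff hd hg hQ hw ha
  refine ⟨?_, h⟩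
  simpa only [ScalarSolitons.solSet_eq_weakSolSet hg hd] using h
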